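/- **Theorem 1.2.** Let $d\ge 1$ be an integer and let $\mathcal C$ be an additive category. *Definitions.* A sequence $A_{d+1}\xrightarrow{\partial_{d+1}}A_d\to\cdots\to A_1\xrightarrow{\partial_1}A_0$ in $\mathcal C$ is *left $d$-exact* if $0\to\mathcal C(-,A_{d+1})\to\cdots\to\mathcal C(-,A_1)\to\mathcal C(-,A_0)$ is exact, *right $d$-exact* if $0\to\mathcal C(A_0,-)\to\mathcal C(A_1,-)\to\cdots\to\mathcal C(A_{d+1},-)$ is exact, and *$d$-exact* if it is both. The category $\mathcal C$ *has $d$-kernels* if every morphism is the last morphism $\partial_1$ of a left $d$-exact sequence. A morphism $f$ of $d$-exact sequences is a *weak isomorphism* if $f_k$ and $f_{k+1}$ are isomorphisms for some $k\in\{0,\dots,d+1\}$, where $f_{d+2}:=f_0$. The pair $(\mathcal C,\mathcal E)$ is a *$d$-exact category* if $\mathcal E$ is a class of $d$-exact sequences in $\mathcal C$ (called *$\mathcal E$-admissible*; for such a sequence $\partial_{d+1}$ is called an *inflation* and $\partial_1$ a *deflation*) such that: * if two $d$-exact sequences are connected by a weak isomorphism and one of them lies in $\mathcal E$, then so does the other;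 * the zero sequence lies in $\mathcal E$; * inflations are closed under composition, and so are deflations; * for each $B_\bullet\in\mathcal E$ and each morphism $g\colon C_0\to B_0$ there are $C_\bullet\in\mathcal E$ ending in $C_0$ with $C_{d+1}=B_{d+1}$ and a morphism $f\colon C_\bullet\to B_\bullet$ with $f_0=g$ and $f_{d+1}=\mathrm{id}$ whose part in degrees $0,\dots,d$ is a *$d$-pullback diagram*, i.e. the mapping cone sequence $C_d\to C_{d-1}\oplus B_d\to\cdots\to C_0\oplus B_1\to B_0$ is left $d$-exact; and dually, for each $B_\bullet\in\mathcal E$ and each morphism $h\colon B_{d+1}\to D_{d+1}$ there are $D_\bullet\in\mathcal E$ starting in $D_{d+1}$ with $D_0=B_0$ and a morphism $f\colon B_\bullet\to D_\bullet$ with $f_{d+1}=h$ and $f_0=\mathrm{id}$ such that $B_{d+1}\to B_d\oplus D_{d+1}\to\cdots\to B_1\oplus D_2\to D_1$ is right $d$-exact. A full subcategory $\mathcal X\subseteq\mathcal C$ is an *additive subcategory* if it is closed under isomorphisms, finite direct sums and direct summands. It is *contravariantly finite* if each $C\in\mathcal C$ admits a morphism $x\colon X\to C$ with $X\in\mathcal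 X$ such that $\mathcal C(X',x)$ is surjective for all $X'\in\mathcal X$, and *generating* if each $C\in\mathcal C$ admits a deflation $X\to C$ with $X\in\mathcal X$. Let $\mathcal E_{\mathcal X}\subseteq\mathcal E$ be the class of those $B_\bullet\in\mathcal E$ for which $\mathcal C(-,\partial_1^B)|_{\mathcal X}\colon\mathcal C(-,B_1)|_{\mathcal X}\to\mathcal C(-,B_0)|_{\mathcal X}$ is an epimorphism. The split Grothendieck group $K_0^{\mathrm{sp}}(\mathcal C)$ is the free abelian group on isomorphism classes of objects of $\mathcal C$ modulo $[A]-[B]+[C]$ for all split short exact sequences $A\to B\to C$; $K_0(\mathcal C,\mathcal E_{\mathcal X})$ is the quotient of $K_0^{\mathrm{sp}}(\mathcal C)$ by the subgroup generated by $\sum_{i=0}^{d+1}(-1)^i[B_i]$ for $B_\bullet\in\mathcal E_{\mathcal X}$, and $[A]_{\mathcal X}$ denotes the class of $A$ in it. Let $\operatorname{mod}\mathcal X$ be the category of finitely presented $\mathcal X$-modules, i.e. of additive functors $M\colon\mathcal X^{\mathrm{op}}\to\mathrm{Ab}$ having an exact sequence $\mathcal X(-,A)\to\mathcal X(-,B)\to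 M\to 0$ with $A,B\in\mathcal X$; $K_0(\operatorname{mod}\mathcal X)$ is its split Grothendieck group modulo $[M']-[M]+[M'']$ for all short exact sequences $0\to M'\to M\to M''\to 0$ of functors in $\operatorname{mod}\mathcal X$. *Statement.* Suppose that $(\mathcal C,\mathcal E)$ is a skeletally small, idempotent complete $d$-exact category that has $d$-kernels, and let $\mathcal X\subseteq\mathcal C$ be a contravariantly finite, generating, additive subcategory. Then there is a group homomorphism $$\theta_{\mathcal X}\colon K_0(\operatorname{mod}\mathcal X)\to K_0(\mathcal C,\mathcal E_{\mathcal X})$$ such that for every $\mathcal E$-admissible $d$-exact sequence $A_{d+1}\xrightarrow{\partial_{d+1}}A_d\to\cdots\to A_1\xrightarrow{\partial_1}A_0$ the functor $\operatorname{Coker}\big(\mathcal C(-,\partial_1)|_{\mathcal X}\big)$ is a finitely presented $\mathcal X$-module and $$\theta_{\mathcal X}\big(\big[\operatorname{Coker}\big(\mathcal C(-,\partial_1)|_{\mathcal X}\big)\big]\big)=\sum_{i=0}^{d+1}(-1)^i[A_i]_{\mathcal X}.$$ -/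

import Mathlib

open CategoryTheory CategoryTheory.Limits

universe v u

namespace HigherExact

noncomputable section

/-! ## Sequences `B_{d+1} ⟶ B_d ⟶ ⋯ ⟶ B_1 ⟶ B_0`

Such a sequence (with consecutive compositions zero) is a chain complex indexed by `ℕ` whose terms
in degrees `> d + 1` are zero objects; its differential `∂_{i+1}` is `B.d (i + 1) i`. -/

section Sequences

variable {C : Type u} [Category.{v} C] [Preadditive C]

/-- The terms of `B` in degrees `> n` are zero objects. -/
def IsConcentrated (n : ℕ) (B : ChainComplex C ℕ) : Prop :=
  ∀ i, n < i → IsZero (B.X i)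

/-- `B_{d+1} ⟶ ⋯ ⟶ B_1 ⟶ B_0` is left `d`-exact: for every object `T` the sequence
`0 ⟶ C(T, B_{d+1}) ⟶ C(T, B_d) ⟶ ⋯ ⟶ C(T, B_1) ⟶ C(T, B_0)` of abelian groups is exact.
(Exactness at `C(T, B_{d+1})` is the case `i = d`, because `B_{d+2} = 0`.) -/
structure IsLeftDExact (d : ℕ) (B : ChainComplex C ℕ) : Prop where
  concentrated : IsConcentrated (d + 1) B
  exact : ∀ (T : C) (i : ℕ), Function.Exact
    (fun a : T ⟶ B.X (i + 2) => a ≫ B.d (i + 2) (i + 1))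
    (fun a : T ⟶ B.X (i + 1) => a ≫ B.d (i + 1) i)

/-- `B_{d+1} ⟶ B_d ⟶ ⋯ ⟶ B_0` is right `d`-exact: for every object `T` the sequence
`0 ⟶ C(B_0, T) ⟶ C(B_1, T) ⟶ ⋯ ⟶ C(B_d, T) ⟶ C(B_{d+1}, T)` of abelian groups is exact. -/
structure IsRightDExact (d : ℕ) (B : ChainComplex C ℕ) : Prop where
  concentrated : IsConcentrated (d + 1) B
  injective : ∀ T : C, Function.Injective (fun a : B.X 0 ⟶ T => B.d 1 0 ≫ a)
  exact : ∀ (T : C) (i : ℕ), i < d → Function.Exact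
    (fun a : B.X i ⟶ T => B.d (i + 1) i ≫ a)
    (fun a : B.X (i + 1) ⟶ T => B.d (i + 2) (i + 1) ≫ a)

/-- `B` is a `d`-exact sequence: both left and right `d`-exact. -/
def IsDExact (d : ℕ) (B : ChainComplex C ℕ) : Prop :=
  IsLeftDExact d B ∧ IsRightDExact d B

/-- A morphism of `d`-exact sequences is a weak isomorphism if two cyclically consecutive
components of it are isomorphisms, that is `f_k` and `f_{k+1}` for some `0 ≤ k ≤ d`,
or `f_{d+1}` and `f_0`. -/
def IsWeakIso (d : ℕ) {A B : ChainComplex C ℕ} (f : A ⟶ B) : Prop :=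
  (∃ k, k ≤ d ∧ IsIso (f.f k) ∧ IsIso (f.f (k + 1))) ∨ (IsIso (f.f (d + 1)) ∧ IsIso (f.f 0))

/-- The part of `f : A ⟶ B` in degrees `0, …, d` is a `d`-pullback diagram: the sequence
`A_d ⟶ A_{d-1} ⊕ B_d ⟶ ⋯ ⟶ A_0 ⊕ B_1 ⟶ B_0` obtained from the mapping cone, with differentials
`(a, b) ↦ (- ∂a, f a + ∂b)`, is left `d`-exact. Here this is written out for morphisms `a`, `b`
from an arbitrary test object `T`; the degree `d + 1` parts of `A` and `B` are left out.
(For `j = 0`, `A.d j (j - 1) = A.d 0 0 = 0`.) -/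
structure IsDPullback (d : ℕ) {A B : ChainComplex C ℕ} (f : A ⟶ B) : Prop where
  /-- exactness at `A_d` -/
  injective : ∀ (T : C) (a : T ⟶ A.X d),
    a ≫ A.d d (d - 1) = 0 → a ≫ f.f d = 0 → a = 0
  /-- exactness at `A_j ⊕ B_{j+1}` for `0 ≤ j < d` -/
  exact : ∀ (T : C) (j : ℕ), j < d → ∀ (a : T ⟶ A.X j) (b : T ⟶ B.X (j + 1)),
    a ≫ A.d j (j - 1) = 0 → a ≫ f.f j + b ≫ B.d (j + 1) j = 0 →
    ∃ (a' : T ⟶ A.X (j + 1)) (b' : T ⟶ B.X (j + 2)),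
      (j + 1 = d → b' = 0) ∧
      a = -(a' ≫ A.d (j + 1) j) ∧
      b = a' ≫ f.f (j + 1) + b' ≫ B.d (j + 2) (j + 1)

/-- The part of `f : A ⟶ B` in degrees `1, …, d + 1` is a `d`-pushout diagram: the sequence
`A_{d+1} ⟶ A_d ⊕ B_{d+1} ⟶ ⋯ ⟶ A_1 ⊕ B_2 ⟶ B_1` obtained from the mapping cone, with
differentials `(a, b) ↦ (- ∂a, f a + ∂b)`, is right `d`-exact. Here this is written out for
morphisms `a`, `b` to an arbitrary test object `T`; the degree `0` parts of `A` and `B` are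
left out. (For `j = d`, `B_{d+2} = 0` when `B` is concentrated in degrees `≤ d + 1`.) -/
structure IsDPushout (d : ℕ) {A B : ChainComplex C ℕ} (f : A ⟶ B) : Prop where
  /-- exactness at `B_1` -/
  injective : ∀ (T : C) (b : B.X 1 ⟶ T),
    f.f 1 ≫ b = 0 → B.d 2 1 ≫ b = 0 → b = 0
  /-- exactness at `A_j ⊕ B_{j+1}` for `1 ≤ j ≤ d` -/
  exact : ∀ (T : C) (j : ℕ), 1 ≤ j → j ≤ d → ∀ (a : A.X j ⟶ T) (b : B.X (j + 1) ⟶ T),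
    -(A.d (j + 1) j ≫ a) + f.f (j + 1) ≫ b = 0 → B.d (j + 2) (j + 1) ≫ b = 0 →
    ∃ (a' : A.X (j - 1) ⟶ T) (b' : B.X j ⟶ T),
      (j = 1 → a' = 0) ∧
      a = -(A.d j (j - 1) ≫ a') + f.f j ≫ b' ∧
      b = B.d (j + 1) j ≫ b'

end Sequences

/-! ## `d`-exact categories -/

section DExactCategories

variable {C : Type u} [Category.{v} C] [Preadditive C]

/-- The `E`-admissible inflations: the morphisms `∂_{d+1}` of members of `E`, up to isomorphism. -/
def inflations (d : ℕ) (E : ObjectProperty (ChainComplex C ℕ)) : MorphismProperty C :=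
  fun _ _ f => ∃ B, E B ∧ Nonempty (Arrow.mk f ≅ Arrow.mk (B.d (d + 1) d))

/-- The `E`-admissible deflations: the morphisms `∂_1` of members of `E`, up to isomorphism. -/
def deflations (E : ObjectProperty (ChainComplex C ℕ)) : MorphismProperty C :=
  fun _ _ f => ∃ B, E B ∧ Nonempty (Arrow.mk f ≅ Arrow.mk (B.d 1 0))

/-- The class `E` of sequences makes the additive category `C` into a `d`-exact category. -/
structure IsDExactStructure (d : ℕ) (E : ObjectProperty (ChainComplex C ℕ)) : Prop where
  /-- `E` consists of `d`-exact sequences. -/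
  isDExact : ∀ B, E B → IsDExact d B
  /-- `E` is closed under weak isomorphisms of `d`-exact sequences. -/
  weakIso : ∀ {A B : ChainComplex C ℕ} (f : A ⟶ B), IsDExact d A → IsDExact d B →
    IsWeakIso d f → (E A ↔ E B)
  /-- The zero complex belongs to `E`. -/
  zero : ∀ B, IsZero B → E B
  /-- Inflations are closed under composition. -/
  inflation_comp : ∀ {X Y Z : C} (f : X ⟶ Y) (g : Y ⟶ Z),
    inflations d E f → inflations d E g → inflations d E (f ≫ g)
  /-- Deflations are closed under composition. -/
  deflation_comp : ∀ {X Y Z : C} (f : X ⟶ Y) (g : Y ⟶ Z),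
    deflations E f → deflations E g → deflations E (f ≫ g)
  /-- Members `B` of `E` have `d`-pushouts in `E` along each `h : B_{d+1} ⟶ Y`, with the same
  term in degree `0`. -/
  pushout : ∀ (B : ChainComplex C ℕ), E B → ∀ (Y : C) (h : B.X (d + 1) ⟶ Y),
    ∃ (D : ChainComplex C ℕ) (f : B ⟶ D) (e : Y ≅ D.X (d + 1)),
      E D ∧ f.f (d + 1) = h ≫ e.hom ∧ IsIso (f.f 0) ∧ IsDPushout d f
  /-- Members `B` of `E` have `d`-pullbacks in `E` along each `g : Y ⟶ B_0`, with the same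
  term in degree `d + 1`. -/
  pullback : ∀ (B : ChainComplex C ℕ), E B → ∀ (Y : C) (g : Y ⟶ B.X 0),
    ∃ (A : ChainComplex C ℕ) (f : A ⟶ B) (e : A.X 0 ≅ Y),
      E A ∧ f.f 0 = e.hom ≫ g ∧ IsIso (f.f (d + 1)) ∧ IsDPullback d f

variable (C) in
/-- `C` has `d`-kernels: every morphism is the last morphism `∂_1` of a left `d`-exact sequence
(up to isomorphism). -/
def HasDKernels (d : ℕ) : Prop :=
  ∀ {X Y : C} (f : X ⟶ Y), ∃ B : ChainComplex C ℕ,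
    IsLeftDExact d B ∧ Nonempty (Arrow.mk f ≅ Arrow.mk (B.d 1 0))

end DExactCategories

/-! ## Subcategories

A full subcategory of `C` is given by the property `P` of belonging to it. -/

section Subcategories

variable {C : Type u} [Category.{v} C]

/-- A full subcategory closed under isomorphisms, finite direct sums and direct summands. -/
structure IsAdditiveSubcategory [Preadditive C] [HasBinaryBiproducts C]
    (P : ObjectProperty C) : Prop where
  iso : ∀ {A B : C}, (A ≅ B) → P A → P B
  zero : ∀ A : C, IsZero A → P A
  biprod : ∀ A B : C, P A → P B → P (A ⊞ B)
  summand : ∀ A B : C, P (A ⊞ B) → P A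

/-- `x : X ⟶ Y` is a right `P`-approximation of `Y`. -/
def IsRightApproximation (P : ObjectProperty C) {X Y : C} (x : X ⟶ Y) : Prop :=
  P X ∧ ∀ X' : C, P X' → Function.Surjective (fun a : X' ⟶ X => a ≫ x)

/-- Every object of `C` has a right `P`-approximation. -/
def IsContravariantlyFinite (P : ObjectProperty C) : Prop :=
  ∀ Y : C, ∃ (X : C) (x : X ⟶ Y), IsRightApproximation P x

/-- Every object of `C` admits an `E`-admissible deflation from an object of `P`. -/
def IsGenerating [Preadditive C] (E : ObjectProperty (ChainComplex C ℕ))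
    (P : ObjectProperty C) : Prop :=
  ∀ Y : C, ∃ (X : C) (x : X ⟶ Y), P X ∧ deflations E x

end Subcategories

/-! ## Modules over a category -/

section Modules

variable (D : Type u) [Category.{v} D] [Preadditive D]

/-- The finitely presented `D`-modules: additive functors `M : Dᵒᵖ ⥤ Ab` for which there is an
exact sequence `D(-, A) ⟶ D(-, B) ⟶ M ⟶ 0`. -/
def finitelyPresented : ObjectProperty (Dᵒᵖ ⥤ AddCommGrpCat.{v}) := fun M =>
  M.Additive ∧ ∃ (A B : D) (a : preadditiveYoneda.obj A ⟶ preadditiveYoneda.obj B)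
    (b : preadditiveYoneda.obj B ⟶ M) (w : a ≫ b = 0), (ShortComplex.mk a b w).Exact ∧ Epi b

/-- The category `mod D` of finitely presented `D`-modules. -/
abbrev FPMod := (finitelyPresented D).FullSubcategory

/-- The short exact sequences of functors `0 ⟶ M_2 ⟶ M_1 ⟶ M_0 ⟶ 0` in `mod D`. -/
def shortExactSequences : ObjectProperty (ChainComplex (FPMod D) ℕ) := fun M =>
  IsConcentrated 2 M ∧
    (((finitelyPresented D).ι.mapHomologicalComplex (ComplexShape.down ℕ)).obj M).Acyclic

variable {D}

/-- The functor `A ↦ C(-, A)|_P` from `C` to modules over the full subcategory `P`. -/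
abbrev restrictedYoneda {C : Type u} [Category.{v} C] [Preadditive C] (P : ObjectProperty C) :
    C ⥤ P.FullSubcategoryᵒᵖ ⥤ AddCommGrpCat.{v} :=
  preadditiveYoneda ⋙ (Functor.whiskeringLeft _ _ _).obj P.ι.op

/-- The relative class `E_P`: the members `B` of `E` such that
`C(-, ∂_1)|_P : C(-, B_1)|_P ⟶ C(-, B_0)|_P` is an epimorphism. -/
def relativeClass {C : Type u} [Category.{v} C] [Preadditive C]
    (E : ObjectProperty (ChainComplex C ℕ)) (P : ObjectProperty C) :
    ObjectProperty (ChainComplex C ℕ) := fun B =>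
  E B ∧ Epi ((restrictedYoneda P).map (B.d 1 0))

end Modules

/-! ## Grothendieck groups -/

section GrothendieckGroups

variable (C : Type u) [Category.{v} C] [Preadditive C]

/-- The free abelian group on the isomorphism classes of objects of `C`. -/
abbrev FreeOnIso := FreeAbelianGroup (Quotient (isIsomorphicSetoid C))

/-- The isomorphism class of `A` as an element of the free abelian group. -/
def isoClass {C : Type u} [Category.{v} C] (A : C) :
    FreeAbelianGroup (Quotient (isIsomorphicSetoid C)) :=
  FreeAbelianGroup.of (Quotient.mk (isIsomorphicSetoid C) A)

/-- The relations `[X_1] - [X_2] + [X_3]` for split short exact sequences `X_1 ⟶ X_2 ⟶ X_3`. -/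
def splitRelations : AddSubgroup (FreeOnIso C) :=
  AddSubgroup.closure {x | ∃ S : ShortComplex C, Nonempty S.Splitting ∧
    x = isoClass S.X₁ - isoClass S.X₂ + isoClass S.X₃}

/-- The split Grothendieck group of `C`. -/
abbrev SplitK0 := FreeOnIso C ⧸ splitRelations C

variable {C}

/-- The class of `A` in the split Grothendieck group. -/
def splitClass (A : C) : SplitK0 C := QuotientAddGroup.mk (isoClass A)

/-- The relations `∑_{i=0}^{d+1} (-1)^i [B_i]` in the split Grothendieck group, for `B` in `E`. -/
def relations (d : ℕ) (E : ObjectProperty (ChainComplex C ℕ)) : AddSubgroup (SplitK0 C) :=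
  AddSubgroup.closure {x | ∃ B : ChainComplex C ℕ, E B ∧
    x = ∑ i ∈ Finset.range (d + 2), (-1 : ℤ) ^ i • splitClass (B.X i)}

/-- The Grothendieck group `K₀(C, E)` of a class `E` of sequences with `d + 2` terms. -/
abbrev K0 (d : ℕ) (E : ObjectProperty (ChainComplex C ℕ)) := SplitK0 C ⧸ relations d E

/-- The class of `A` in `K₀(C, E)`. -/
def K0.cls (d : ℕ) (E : ObjectProperty (ChainComplex C ℕ)) (A : C) : K0 d E :=
  QuotientAddGroup.mk (splitClass A)

end GrothendieckGroups

/-- The Grothendieck group of `mod D`, the abelian category `mod D` being viewed as a `1`-exact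
category through its short exact sequences. -/
abbrev K0Mod (D : Type u) [Category.{v} D] [Preadditive D] := K0 1 (shortExactSequences D)

/-- The class of a finitely presented module in `K₀(mod D)`. -/
abbrev K0Mod.cls {D : Type u} [Category.{v} D] [Preadditive D] (M : FPMod D) : K0Mod D :=
  K0.cls 1 (shortExactSequences D) M

end

end HigherExact

/-!
The Euler characteristic `χ(K) = ∑ (-1)^i [K_i]` in `K₀(C, E_X)` makes sense for every bounded
complex `K` in `C`. A finitely presented `X`-module `M` is the cokernel of `C(-, f)|_X` for a
morphism `f` of `X`; a `d`-kernel of `f` gives a left `d`-exact complex `K`, and `θ [M] = χ(K)`.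
All that has to be shown is that `χ(K)` depends only on the module that `K` presents, and that it is
additive on short exact sequences. Indeed, for `A` in `E`, the complex `A` itself is left
`d`-exact and presents the cokernel of `C(-, ∂_1)|_X`.

Independence reduces to one vanishing statement: two complexes presenting the same module are
related by a chain map whose cone, of length `d + 2`, is exact on `X`, and such a complex
has `χ = 0` (`IsDExactStructure.euler_eq_zero_of_isExactOn`). Its proof has three ingredients.

* `IsDExactStructure.isLeftDExact_of_isExactOn`: a complex of length `d + 1` whose exactness in
  positive degrees holds on `X` is left `d`-exact, because an arbitrary object `T` is the last term
  `B_0` of some `B` in `E` with `B_1` in `X`, and `B` is right `d`-exact. One comparison with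
  a `d`-kernel brings the length down from `d + 2` to `d + 1`.
* `IsDExactStructure.euler_eq_zero_of_isLeftDExact`: if `K` is left `d`-exact and `K_1 ⟶ K_0` is
  an epimorphism on `X`, then `χ(K) = 0`. Here `K` is homotopy equivalent to the cone of a
  `d`-pullback `A ⟶ B` of sequences in `E_X`, so that `χ(K) = χ(B) - χ(A) = 0`.
* `IsDExactStructure.exists_relativeClass`: the sequence `B` needed there exists, because `(q, x)`
  is a deflation whenever `q` is one (`IsDExactStructure.deflations_desc`).

Additivity (`IsDExactStructure.euler_add`) follows from independence: for `0 ⟶ M' ⟶ M ⟶ M'' ⟶ 0`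
one chooses compatible complexes for `M` and `M''`, and a shifted cone of the map between them
presents `M'`.
-/

namespace HigherExact

noncomputable section

/-! ### Exactness tested on an object, and mapping cones -/

section Cones

variable {C : Type u} [Category.{v} C] [Preadditive C]

/-- `C(T, K)` is exact in degree `i`: cycles `T ⟶ K_i` are boundaries. In degree `0` every
morphism is a cycle, because `K.d 0 0 = 0`. -/
def IsExactOn (T : C) (K : ChainComplex C ℕ) (i : ℕ) : Prop :=
  ∀ a : T ⟶ K.X i, a ≫ K.d i (i - 1) = 0 → ∃ b : T ⟶ K.X (i + 1), b ≫ K.d (i + 1) i = a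

lemma IsLeftDExact.isExactOn {d : ℕ} {K : ChainComplex C ℕ} (hK : IsLeftDExact d K) (T : C)
    (i : ℕ) : IsExactOn T K (i + 1) :=
  fun a ha => (hK.exact T i a).1 ha

lemma IsLeftDExact.of_isExactOn {d : ℕ} {K : ChainComplex C ℕ} (h : IsConcentrated (d + 1) K)
    (hK : ∀ T i, IsExactOn T K (i + 1)) : IsLeftDExact d K where
  concentrated := h
  exact T i a := by
    refine ⟨fun ha => hK T i a ha, ?_⟩
    rintro ⟨b, rfl⟩
    simp

lemma IsConcentrated.mono {m n : ℕ} (h : m ≤ n) {K : ChainComplex C ℕ} (hK : IsConcentrated m K) :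
    IsConcentrated n K :=
  fun i hi => hK i (by lia)

lemma IsConcentrated.isExactOn {n : ℕ} {K : ChainComplex C ℕ} (hK : IsConcentrated n K) (T : C)
    {i : ℕ} (hi : n < i) : IsExactOn T K i :=
  fun _ _ => ⟨0, (hK i hi).eq_of_tgt _ _⟩

/-- Into a complex that is exact in positive degrees, compatible morphisms in degrees `0` and `1`
extend to a chain map. -/
lemma exists_hom {K L : ChainComplex C ℕ} (f₀ : K.X 0 ⟶ L.X 0) (f₁ : K.X 1 ⟶ L.X 1)
    (w : f₁ ≫ L.d 1 0 = K.d 1 0 ≫ f₀) (hL : ∀ i, IsExactOn (K.X (i + 2)) L (i + 1)) :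
    ∃ f : K ⟶ L, f.f 0 = f₀ ∧ f.f 1 = f₁ := by
  have H : ∀ (n : ℕ) (p : Σ' (f : K.X n ⟶ L.X n) (f' : K.X (n + 1) ⟶ L.X (n + 1)),
      f' ≫ L.d (n + 1) n = K.d (n + 1) n ≫ f),
      ∃ f'' : K.X (n + 2) ⟶ L.X (n + 2), f'' ≫ L.d (n + 2) (n + 1) = K.d (n + 2) (n + 1) ≫ p.2.1 :=
    fun n p => hL n _ (by
      show (K.d (n + 2) (n + 1) ≫ p.2.1) ≫ L.d (n + 1) n = 0
      rw [Category.assoc, p.2.2, ← Category.assoc, K.d_comp_d, zero_comp])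
  exact ⟨ChainComplex.mkHom K L f₀ f₁ w (fun n p => ⟨(H n p).choose, (H n p).choose_spec⟩),
    rfl, rfl⟩

variable [HasBinaryBiproducts C]

/-- The terms of the mapping cone of `φ : F ⟶ G`. -/
def coneX {F G : ChainComplex C ℕ} (_ : F ⟶ G) : ℕ → C
  | 0 => G.X 0
  | i + 1 => F.X i ⊞ G.X (i + 1)

/-- The differentials `(a, b) ↦ (-∂a, φ a + ∂b)` of the mapping cone of `φ : F ⟶ G`. -/
def coneD {F G : ChainComplex C ℕ} (φ : F ⟶ G) : ∀ i, coneX φ (i + 1) ⟶ coneX φ i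
  | 0 => biprod.desc (φ.f 0) (G.d 1 0)
  | i + 1 => biprod.desc (biprod.lift (-F.d (i + 1) i) (φ.f (i + 1)))
      (biprod.lift 0 (G.d (i + 2) (i + 1)))

lemma coneD_comp_coneD {F G : ChainComplex C ℕ} (φ : F ⟶ G) :
    ∀ i, coneD φ (i + 1) ≫ coneD φ i = 0
  | 0 => by
    change biprod.desc (biprod.lift (-F.d 1 0) (φ.f 1)) (biprod.lift 0 (G.d 2 1)) ≫
      biprod.desc (φ.f 0) (G.d 1 0) = 0
    apply biprod.hom_ext' <;> simp
  | i + 1 => by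
    change biprod.desc (biprod.lift (-F.d (i + 2) (i + 1)) (φ.f (i + 2)))
        (biprod.lift 0 (G.d (i + 3) (i + 2))) ≫
      biprod.desc (biprod.lift (-F.d (i + 1) i) (φ.f (i + 1)))
        (biprod.lift 0 (G.d (i + 2) (i + 1))) = 0
    apply biprod.hom_ext' <;> apply biprod.hom_ext <;> simp

/-- The mapping cone of a chain map `φ : F ⟶ G`, with terms `G_0` and `F_i ⊞ G_{i+1}`. -/
def cone {F G : ChainComplex C ℕ} (φ : F ⟶ G) : ChainComplex C ℕ :=
  ChainComplex.of (coneX φ) (coneD φ) (coneD_comp_coneD φ)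

variable {F G : ChainComplex C ℕ} (φ : F ⟶ G)

/-- The morphism `(a, b)` to `F_i ⊞ G_{i+1}`, seen as the term of degree `i + 1` of the cone. -/
def toCone {T : C} {i : ℕ} (a : T ⟶ F.X i) (b : T ⟶ G.X (i + 1)) : T ⟶ (cone φ).X (i + 1) :=
  biprod.lift a b

lemma exists_eq_toCone {T : C} {i : ℕ} (c : T ⟶ (cone φ).X (i + 1)) :
    ∃ a b, c = toCone φ a b := by
  change T ⟶ F.X i ⊞ G.X (i + 1) at c
  refine ⟨c ≫ biprod.fst, c ≫ biprod.snd, ?_⟩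
  change c = biprod.lift _ _
  apply biprod.hom_ext <;> simp

lemma toCone_inj {T : C} {i : ℕ} {a a' : T ⟶ F.X i} {b b' : T ⟶ G.X (i + 1)} :
    toCone φ a b = toCone φ a' b' ↔ a = a' ∧ b = b' := by
  constructor
  · intro h
    change biprod.lift a b = biprod.lift a' b' at h
    have h₁ := congrArg (fun t => t ≫ biprod.fst) h
    have h₂ := congrArg (fun t => t ≫ biprod.snd) h
    simp only [biprod.lift_fst, biprod.lift_snd] at h₁ h₂
    exact ⟨h₁, h₂⟩
  · rintro ⟨rfl, rfl⟩
    rfl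

lemma toCone_zero {T : C} {i : ℕ} : toCone φ (0 : T ⟶ F.X i) (0 : T ⟶ G.X (i + 1)) = 0 := by
  change biprod.lift _ _ = (0 : T ⟶ F.X i ⊞ G.X (i + 1))
  apply biprod.hom_ext <;> simp

lemma toCone_d_zero {T : C} (a : T ⟶ F.X 0) (b : T ⟶ G.X 1) :
    toCone φ a b ≫ (cone φ).d 1 0 = a ≫ φ.f 0 + b ≫ G.d 1 0 := by
  have h : (cone φ).d 1 0 = coneD φ 0 := ChainComplex.of_d (coneX φ) (coneD φ) 0
  rw [h]
  exact biprod.lift_desc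

lemma toCone_d_succ {T : C} (i : ℕ) (a : T ⟶ F.X (i + 1)) (b : T ⟶ G.X (i + 2)) :
    toCone φ a b ≫ (cone φ).d (i + 2) (i + 1) =
      toCone φ (-(a ≫ F.d (i + 1) i)) (a ≫ φ.f (i + 1) + b ≫ G.d (i + 2) (i + 1)) := by
  have h : (cone φ).d (i + 2) (i + 1) = coneD φ (i + 1) :=
    ChainComplex.of_d (coneX φ) (coneD φ) (i + 1)
  rw [h]
  change biprod.lift a b ≫ biprod.desc (biprod.lift (-F.d (i + 1) i) (φ.f (i + 1)))
      (biprod.lift 0 (G.d (i + 2) (i + 1))) = biprod.lift _ _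
  rw [biprod.lift_desc]
  apply biprod.hom_ext <;> simp

lemma IsConcentrated.cone {n : ℕ} (hF : IsConcentrated n F) (hG : IsConcentrated (n + 1) G) :
    IsConcentrated (n + 1) (cone φ) := by
  rintro (_ | i) hi
  · lia
  · exact biprod_isZero_iff _ _ |>.2 ⟨hF i (by lia), hG (i + 1) hi⟩

/-- The exactness condition on the cone, written out in degree `i + 1` for the two components
of a cycle. -/
lemma isExactOn_cone_succ_iff {T : C} {i : ℕ} :
    IsExactOn T (cone φ) (i + 1) ↔ ∀ (a : T ⟶ F.X i) (b : T ⟶ G.X (i + 1)),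
      a ≫ F.d i (i - 1) = 0 → a ≫ φ.f i + b ≫ G.d (i + 1) i = 0 →
      ∃ (a' : T ⟶ F.X (i + 1)) (b' : T ⟶ G.X (i + 2)), -(a' ≫ F.d (i + 1) i) = a ∧
        a' ≫ φ.f (i + 1) + b' ≫ G.d (i + 2) (i + 1) = b := by
  have key : ∀ (a : T ⟶ F.X i) (b : T ⟶ G.X (i + 1)),
      toCone φ a b ≫ (cone φ).d (i + 1) i = 0 ↔
        a ≫ F.d i (i - 1) = 0 ∧ a ≫ φ.f i + b ≫ G.d (i + 1) i = 0 := by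
    intro a b
    cases i with
    | zero =>
      rw [show a ≫ F.d 0 (0 - 1) = 0 by simp, ← toCone_d_zero]
      exact ⟨fun h => ⟨rfl, h⟩, And.right⟩
    | succ i =>
      rw [toCone_d_succ, ← toCone_zero, toCone_inj, neg_eq_zero]
      rfl
  constructor
  · intro h a b h₁ h₂
    obtain ⟨c, hc⟩ := h (toCone φ a b) ((key a b).2 ⟨h₁, h₂⟩)
    obtain ⟨a', b', rfl⟩ := exists_eq_toCone φ c
    rw [toCone_d_succ, toCone_inj] at hc
    exact ⟨a', b', hc⟩
  · intro h c hc
    obtain ⟨a, b, rfl⟩ := exists_eq_toCone φ c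
    obtain ⟨h₁, h₂⟩ := (key _ _).1 hc
    obtain ⟨a', b', h₁, h₂⟩ := h _ _ h₁ h₂
    exact ⟨toCone φ a' b', by rw [toCone_d_succ, h₁, h₂]⟩

lemma isExactOn_cone_zero {T : C}
    (h : ∀ b : T ⟶ G.X 0, ∃ (a' : T ⟶ F.X 0) (b' : T ⟶ G.X 1), a' ≫ φ.f 0 + b' ≫ G.d 1 0 = b) :
    IsExactOn T (cone φ) 0 := by
  intro b _
  obtain ⟨a', b', h⟩ := h b
  exact ⟨toCone φ a' b', (toCone_d_zero φ a' b').trans h⟩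

/-- The long exact sequence of a cone: if `C(T, F)` and `C(T, G)` are exact in positive degrees
and `φ` is injective on the homology of degree `0`, then the cone is exact in positive degrees. -/
lemma isExactOn_cone_succ {T : C} (hF : ∀ i, IsExactOn T F (i + 1))
    (hG : ∀ i, IsExactOn T G (i + 1))
    (hφ : ∀ (a : T ⟶ F.X 0) (b : T ⟶ G.X 1), a ≫ φ.f 0 = b ≫ G.d 1 0 →
      ∃ a' : T ⟶ F.X 1, a' ≫ F.d 1 0 = a) (i : ℕ) : IsExactOn T (cone φ) (i + 1) := by
  rw [isExactOn_cone_succ_iff]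
  intro a b h₁ h₂
  have h₂' : a ≫ φ.f i = (-b) ≫ G.d (i + 1) i := by
    rw [Preadditive.neg_comp]; exact eq_neg_of_add_eq_zero_left h₂
  obtain ⟨a', rfl⟩ : ∃ a' : T ⟶ F.X (i + 1), a' ≫ F.d (i + 1) i = a := by
    cases i with
    | zero => exact hφ a _ h₂'
    | succ i => exact hF i a h₁
  obtain ⟨b', hb'⟩ := hG i (b + a' ≫ φ.f (i + 1)) (by
    show (b + a' ≫ φ.f (i + 1)) ≫ G.d (i + 1) i = 0
    rw [Preadditive.add_comp, Category.assoc, φ.comm, ← Category.assoc, add_comm]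
    exact h₂)
  refine ⟨-a', b', by simp, ?_⟩
  rw [hb']
  simp

end Cones

/-! ### Euler characteristics in Grothendieck groups -/

section EulerCharacteristic

variable {C : Type u} [Category.{v} C] [Preadditive C]
  (d : ℕ) (E : ObjectProperty (ChainComplex C ℕ))

lemma K0.cls_eq_of_iso {A B : C} (e : A ≅ B) : K0.cls d E A = K0.cls d E B := by
  have : isoClass A = isoClass B :=
    congrArg FreeAbelianGroup.of (Quotient.sound (s := isIsomorphicSetoid C) ⟨e⟩)
  simp only [K0.cls, splitClass, this]

lemma K0.cls_splitting {S : ShortComplex C} (σ : S.Splitting) :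
    K0.cls d E S.X₁ - K0.cls d E S.X₂ + K0.cls d E S.X₃ = 0 := by
  have h : splitClass S.X₁ - splitClass S.X₂ + splitClass S.X₃ = 0 :=
    (QuotientAddGroup.eq_zero_iff _).2 (AddSubgroup.subset_closure ⟨S, ⟨σ⟩, rfl⟩)
  exact congrArg (QuotientAddGroup.mk (s := relations d E)) h

lemma K0.cls_biprod [HasBinaryBiproducts C] (A B : C) :
    K0.cls d E (A ⊞ B) = K0.cls d E A + K0.cls d E B := by
  have h := K0.cls_splitting d E
    (S := ShortComplex.mk (biprod.inl : A ⟶ A ⊞ B) biprod.snd (by simp))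
    { r := biprod.fst, s := biprod.inr, id := by simp }
  rw [sub_add_eq_add_sub, sub_eq_zero] at h
  exact h.symm

lemma K0.cls_eq_zero {A : C} (hA : IsZero A) : K0.cls d E A = 0 := by
  have h := K0.cls_splitting d E (S := ShortComplex.mk (𝟙 A) (𝟙 A) (hA.eq_of_src _ _))
    { r := 𝟙 A, s := 𝟙 A, f_r := by simp, s_g := by simp, id := hA.eq_of_src _ _ }
  simpa using h

/-- The Euler characteristic `∑_{i=0}^n (-1)^i [K_i]` in `K₀(C, E)`. -/
def euler (n : ℕ) (K : ChainComplex C ℕ) : K0 d E :=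
  ∑ i ∈ Finset.range (n + 1), (-1 : ℤ) ^ i • K0.cls d E (K.X i)

lemma euler_succ (n : ℕ) (K : ChainComplex C ℕ) :
    euler d E (n + 1) K =
      K0.cls d E (K.X 0) - euler d E n (ChainComplex.truncate.obj K) := by
  simp only [euler]
  rw [Finset.sum_range_succ', sub_eq_neg_add, ← Finset.sum_neg_distrib]
  simp [pow_succ, ChainComplex.truncate]

variable {d E}

lemma euler_eq_of_le {m n : ℕ} {K : ChainComplex C ℕ} (hK : IsConcentrated m K) (h : m ≤ n) :
    euler d E n K = euler d E m K := by
  induction n, h using Nat.le_induction with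
  | base => rfl
  | succ n h ih =>
    rw [euler, Finset.sum_range_succ, K0.cls_eq_zero _ _ (hK (n + 1) (by lia)), smul_zero, add_zero]
    exact ih

lemma euler_eq_zero_of_mem {B : ChainComplex C ℕ} (hB : E B) : euler d E (d + 1) B = 0 := by
  have h : (∑ i ∈ Finset.range (d + 2), (-1 : ℤ) ^ i • splitClass (B.X i) : SplitK0 C) ∈
    relations d E := AddSubgroup.subset_closure ⟨B, hB, rfl⟩
  have := (QuotientAddGroup.eq_zero_iff _).2 h
  rw [← QuotientAddGroup.mk'_apply, map_sum] at this
  simp only [map_zsmul] at this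
  exact this

lemma euler_cone [HasBinaryBiproducts C] {F G : ChainComplex C ℕ} (φ : F ⟶ G) (n : ℕ) :
    euler d E (n + 1) (cone φ) = euler d E (n + 1) G - euler d E n F := by
  have h : ∀ i, K0.cls d E ((cone φ).X (i + 1)) = K0.cls d E (F.X i) + K0.cls d E (G.X (i + 1)) :=
    fun i => K0.cls_biprod d E _ _
  simp only [euler]
  rw [Finset.sum_range_succ', Finset.sum_range_succ' _ (n + 1), sub_eq_neg_add,
    ← Finset.sum_neg_distrib, ← add_assoc, ← Finset.sum_add_distrib]
  simp only [h, pow_succ, smul_add, mul_neg, mul_one, neg_smul, neg_add]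
  rfl

lemma IsConcentrated.truncate {n : ℕ} {K : ChainComplex C ℕ} (hK : IsConcentrated (n + 1) K) :
    IsConcentrated n (ChainComplex.truncate.obj K) :=
  fun i hi => hK (i + 1) (by lia)

/-- A bounded complex that is exact on all objects of `C` is built from split exact sequences:
idempotent completeness splits off `K_0` from `K_1`, and the rest is a shorter complex of the
same kind. -/
lemma euler_eq_zero_of_contractible [HasBinaryBiproducts C] [IsIdempotentComplete C] (n : ℕ)
    (K : ChainComplex C ℕ) (hn : IsConcentrated n K) (hK : ∀ T i, IsExactOn T K i) :
    euler d E n K = 0 := by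
  induction n generalizing K with
  | zero =>
    have : IsZero (K.X 0) := by
      obtain ⟨b, hb⟩ := hK _ 0 (𝟙 (K.X 0)) (by simp)
      rw [IsZero.iff_id_eq_zero, ← hb, (hn 1 (by lia)).eq_of_tgt b 0, zero_comp]
    simp [euler, K0.cls_eq_zero d E this]
  | succ n ih =>
    obtain ⟨s, hs⟩ := hK _ 0 (𝟙 (K.X 0)) (by simp)
    change s ≫ K.d 1 0 = _ at hs
    obtain ⟨Y, ι, π, h₁, h₂⟩ := IsIdempotentComplete.idempotents_split (K.X 1)
      (𝟙 _ - K.d 1 0 ≫ s) (by simp [reassoc_of% hs])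
    have hι : ι ≫ K.d 1 0 = 0 := by
      have : ι ≫ K.d 1 0 = ι ≫ (π ≫ ι) ≫ K.d 1 0 := by simp [reassoc_of% h₁]
      rw [this, h₂]
      simp [hs]
    have hdπ : K.d 2 1 ≫ π ≫ ι = K.d 2 1 := by simp [h₂]
    let S : ShortComplex C := ShortComplex.mk ι (K.d 1 0) hι
    have hS := K0.cls_splitting d E (S := S)
      { r := π, s := s, f_r := h₁, s_g := hs, id := by simp [S, h₂] }
    -- the complex `⋯ ⟶ K_3 ⟶ K_2 ⟶ Y`, where `Y` is the kernel of `K_1 ⟶ K_0`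
    let L : ChainComplex C ℕ := ChainComplex.augment
      (ChainComplex.truncate.obj (ChainComplex.truncate.obj K)) (X := Y) (K.d 2 1 ≫ π) (by
        change K.d 3 2 ≫ K.d 2 1 ≫ π = 0
        simp)
    have hL : euler d E n L = 0 := by
      apply ih
      · rintro (_ | i) hi
        · lia
        · exact hn (i + 2) (by lia)
      · rintro T (_ | _ | i) a ha
        · change T ⟶ Y at a
          obtain ⟨b, hb⟩ := hK T 1 (a ≫ ι) (by simp [hι])
          change T ⟶ K.X 2 at b
          change b ≫ K.d 2 1 = a ≫ ι at hb
          refine ⟨b, ?_⟩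
          change b ≫ K.d 2 1 ≫ π = a
          rw [reassoc_of% hb, h₁, Category.comp_id]
        · change T ⟶ K.X 2 at a
          change a ≫ K.d 2 1 ≫ π = 0 at ha
          exact hK T 2 a (by
            change a ≫ K.d 2 1 = 0
            rw [← hdπ, reassoc_of% ha, zero_comp])
        · exact hK T (i + 3) a ha
    have hKL : euler d E n L =
        K0.cls d E Y - K0.cls d E (K.X 1) + euler d E n (ChainComplex.truncate.obj K) := by
      cases n with
      | zero =>
        simp only [euler]
        simp [L, ChainComplex.truncate]
      | succ n =>
        rw [euler_succ, euler_succ]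
        change K0.cls d E Y - euler d E n
          (ChainComplex.truncate.obj (ChainComplex.truncate.obj K)) =
            _ + (K0.cls d E (K.X 1) - _)
        abel
    rw [hKL] at hL
    rw [euler_succ, sub_eq_zero]
    exact add_left_cancel (hS.trans hL.symm)

end EulerCharacteristic

/-! ### Deflations that factor through approximations -/

section Deflations

variable {C : Type u} [Category.{v} C] [Preadditive C]

lemma IsRightDExact.of_exists {d : ℕ} {B : ChainComplex C ℕ} (hB : IsConcentrated (d + 1) B)
    (h₀ : ∀ (T : C) (a : B.X 0 ⟶ T), B.d 1 0 ≫ a = 0 → a = 0)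
    (h : ∀ (T : C) (i : ℕ), i < d → ∀ a : B.X (i + 1) ⟶ T, B.d (i + 2) (i + 1) ≫ a = 0 →
      ∃ b : B.X i ⟶ T, B.d (i + 1) i ≫ b = a) : IsRightDExact d B where
  concentrated := hB
  injective T a b hab := by
    rw [← sub_eq_zero]
    apply h₀
    rw [Preadditive.comp_sub, sub_eq_zero]
    exact hab
  exact T i hi a := by
    refine ⟨fun ha => h T i hi a ha, ?_⟩
    rintro ⟨b, rfl⟩
    simp

lemma isIso_of_isZero {A B : C} (hA : IsZero A) (hB : IsZero B) (f : A ⟶ B) : IsIso f :=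
  ⟨0, hA.eq_of_src _ _, hB.eq_of_src _ _⟩

lemma deflations_of_arrow_iso {E : ObjectProperty (ChainComplex C ℕ)} {A B A' B' : C}
    {f : A ⟶ B} {f' : A' ⟶ B'} (e : Arrow.mk f ≅ Arrow.mk f') (h : deflations E f) :
    deflations E f' := by
  obtain ⟨D, hD, ⟨e'⟩⟩ := h
  exact ⟨D, hD, ⟨e.symm ≪≫ e'⟩⟩

lemma epi_restrictedYoneda_map_iff (P : ObjectProperty C) {A B : C} (f : A ⟶ B) :
    Epi ((restrictedYoneda P).map f) ↔ ∀ T : C, P T → ∀ b : T ⟶ B, ∃ a : T ⟶ A, a ≫ f = b := by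
  rw [NatTrans.epi_iff_epi_app]
  constructor
  · intro h T hT b
    exact (AddCommGrpCat.epi_iff_surjective _).1 (h (.op ⟨T, hT⟩)) b
  · intro h T
    exact (AddCommGrpCat.epi_iff_surjective _).2 fun b => h T.unop.obj T.unop.property b

section AddDisc

variable [HasBinaryBiproducts C]

/-- The direct sum of `B` with the contractible complex `Z = Z` placed in degrees `1` and `0`. -/
def addDisc (B : ChainComplex C ℕ) (Z : C) : ChainComplex C ℕ :=
  ChainComplex.augment
    (ChainComplex.augment (ChainComplex.truncate.obj (ChainComplex.truncate.obj B))
      (X := B.X 1 ⊞ Z) (biprod.lift (B.d 2 1) 0) (by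
        change B.d 3 2 ≫ biprod.lift (B.d 2 1) 0 = 0
        apply biprod.hom_ext <;> simp))
    (X := B.X 0 ⊞ Z) (biprod.map (B.d 1 0) (𝟙 Z)) (by
      change biprod.lift (B.d 2 1) 0 ≫ biprod.map (B.d 1 0) (𝟙 Z) = 0
      apply biprod.hom_ext <;> simp)

lemma isDExact_addDisc {d : ℕ} {B : ChainComplex C ℕ} (hB : IsDExact d B) (Z : C) :
    IsDExact d (addDisc B Z) := by
  have hc : IsConcentrated (d + 1) (addDisc B Z) := by
    rintro (_ | _ | i) hi
    · lia
    · lia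
    · exact hB.1.concentrated (i + 2) hi
  refine ⟨.of_isExactOn hc ?_, .of_exists hc ?_ ?_⟩
  · rintro T (_ | _ | i) a ha
    · change T ⟶ B.X 1 ⊞ Z at a
      change a ≫ biprod.map (B.d 1 0) (𝟙 Z) = 0 at ha
      have h₁ : (a ≫ biprod.fst) ≫ B.d 1 0 = 0 := by
        simpa using congrArg (fun t => t ≫ biprod.fst) ha
      have h₂ : a ≫ biprod.snd = 0 := by
        simpa using congrArg (fun t => t ≫ biprod.snd) ha
      obtain ⟨b, hb⟩ := hB.1.isExactOn T 0 _ h₁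
      refine ⟨b, ?_⟩
      change b ≫ biprod.lift (B.d 2 1) 0 = a
      apply biprod.hom_ext
      · simpa using hb
      · simpa using h₂.symm
    · change T ⟶ B.X 2 at a
      change a ≫ biprod.lift (B.d 2 1) 0 = 0 at ha
      exact hB.1.isExactOn T 1 a (by simpa using congrArg (fun t => t ≫ biprod.fst) ha)
    · exact hB.1.isExactOn T (i + 2) a ha
  · intro T a ha
    change B.X 0 ⊞ Z ⟶ T at a
    change biprod.map (B.d 1 0) (𝟙 Z) ≫ a = 0 at ha
    have h₁ : B.d 1 0 ≫ biprod.inl ≫ a = B.d 1 0 ≫ 0 := by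
      simpa using congrArg (fun t => biprod.inl ≫ t) ha
    have h₂ : biprod.inr ≫ a = 0 := by simpa using congrArg (fun t => biprod.inr ≫ t) ha
    apply biprod.hom_ext'
    · exact (hB.2.injective T h₁).trans comp_zero.symm
    · exact h₂.trans comp_zero.symm
  · rintro T (_ | _ | i) hi a ha
    · change B.X 1 ⊞ Z ⟶ T at a
      change biprod.lift (B.d 2 1) 0 ≫ a = 0 at ha
      obtain ⟨b, hb⟩ := (hB.2.exact T 0 hi (biprod.inl ≫ a)).1 (by
        have h : biprod.lift (B.d 2 1) (0 : _ ⟶ Z) = B.d 2 1 ≫ biprod.inl := by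
          apply biprod.hom_ext <;> simp
        simpa [h] using ha)
      refine ⟨biprod.desc b (biprod.inr ≫ a), ?_⟩
      change biprod.map (B.d 1 0) (𝟙 Z) ≫ _ = a
      apply biprod.hom_ext'
      · simpa using hb
      · simp
    · change B.X 2 ⟶ T at a
      obtain ⟨b, hb⟩ := (hB.2.exact T 1 hi a).1 ha
      refine ⟨biprod.desc b 0, ?_⟩
      change biprod.lift (B.d 2 1) 0 ≫ biprod.desc b 0 = a
      simpa using hb
    · exact (hB.2.exact T (i + 2) hi a).1 ha

/-- A chain map to `B` and a morphism `P_0 ⟶ Z` amount to a chain map to `addDisc B Z`. -/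
def liftAddDisc {P B : ChainComplex C ℕ} {Z : C} (f : P ⟶ B) (e : P.X 0 ⟶ B.X 0 ⊞ Z)
    (h : e ≫ biprod.fst = f.f 0) : P ⟶ addDisc B Z where
  f
    | 0 => e
    | 1 => biprod.lift (f.f 1) (P.d 1 0 ≫ e ≫ biprod.snd)
    | i + 2 => f.f (i + 2)
  comm' := by
    rintro _ (_ | _ | i) rfl
    · change biprod.lift (f.f 1) (P.d 1 0 ≫ e ≫ biprod.snd) ≫ biprod.map (B.d 1 0) (𝟙 Z) =
        P.d 1 0 ≫ e
      apply biprod.hom_ext <;> simp [h]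
    · change f.f 2 ≫ biprod.lift (B.d 2 1) 0 =
        P.d 2 1 ≫ biprod.lift (f.f 1) (P.d 1 0 ≫ e ≫ biprod.snd)
      apply biprod.hom_ext <;> simp
    · exact f.comm _ _

variable {d : ℕ} {E : ObjectProperty (ChainComplex C ℕ)}

/-- The pullback of `B` along the projection `B_0 ⊞ Z ⟶ B_0` is weakly isomorphic to the direct
sum of `B` and `Z = Z`. -/
lemma IsDExactStructure.addDisc_mem (hE : IsDExactStructure d E) (hd : 1 ≤ d)
    {B : ChainComplex C ℕ} (hB : E B) (Z : C) : E (addDisc B Z) := by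
  obtain ⟨P, f, e, hP, h₀, h₁, -⟩ := hE.pullback B hB (B.X 0 ⊞ Z) biprod.fst
  refine (hE.weakIso (liftAddDisc f e.hom h₀.symm) (hE.isDExact P hP)
    (isDExact_addDisc (hE.isDExact B hB) Z) (Or.inr ⟨?_, ?_⟩)).1 hP
  · obtain ⟨k, rfl⟩ := Nat.exists_eq_add_of_le' hd
    exact h₁
  · exact inferInstanceAs (IsIso e.hom)

lemma IsDExactStructure.deflations_map_id (hE : IsDExactStructure d E) (hd : 1 ≤ d) {A B : C}
    {f : A ⟶ B} (hf : deflations E f) (Z : C) : deflations E (biprod.map f (𝟙 Z)) := by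
  obtain ⟨D, hD, ⟨e⟩⟩ := hf
  refine ⟨addDisc D Z, hE.addDisc_mem hd hD Z, ⟨?_⟩⟩
  have w : e.hom.left ≫ D.d 1 0 = f ≫ e.hom.right := e.hom.w
  refine Arrow.isoMk (biprod.mapIso (Arrow.leftFunc.mapIso e) (Iso.refl Z))
    (biprod.mapIso (Arrow.rightFunc.mapIso e) (Iso.refl Z)) ?_
  change biprod.map e.hom.left (𝟙 Z) ≫ biprod.map (D.d 1 0) (𝟙 Z) =
    biprod.map f (𝟙 Z) ≫ biprod.map e.hom.right (𝟙 Z)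
  apply biprod.hom_ext <;> simp [w]

end AddDisc

section ZeroDeflation

variable [HasZeroObject C]

open ZeroObject in
/-- The terms of the contractible complex `Y = Y` placed in degrees `2` and `1`. -/
def discX (Y : C) : ℕ → C
  | 1 => Y
  | 2 => Y
  | _ => 0

/-- The differentials of the contractible complex `Y = Y` placed in degrees `2` and `1`. -/
def discD (Y : C) : ∀ n, discX Y (n + 1) ⟶ discX Y n
  | 1 => 𝟙 Y
  | 0 => 0
  | _ + 2 => 0

/-- The contractible complex `Y = Y` placed in degrees `2` and `1`. -/
def disc (Y : C) : ChainComplex C ℕ :=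
  ChainComplex.of (discX Y) (discD Y) (by
    rintro (_ | _ | _)
    · exact comp_zero
    · exact zero_comp
    · exact zero_comp)

lemma disc_d_two_one (Y : C) : (disc Y).d 2 1 = 𝟙 Y :=
  ChainComplex.of_d (discX Y) (discD Y) 1

lemma isZero_disc_zero (Y : C) : IsZero ((disc Y).X 0) := isZero_zero C

lemma isConcentrated_disc (Y : C) : IsConcentrated 2 (disc Y) := by
  rintro (_ | _ | _ | i) hi
  · lia
  · lia
  · lia
  · exact isZero_zero C

lemma isDExact_disc {d : ℕ} (hd : 1 ≤ d) (Y : C) : IsDExact d (disc Y) := by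
  have hc : IsConcentrated (d + 1) (disc Y) := (isConcentrated_disc Y).mono (by lia)
  refine ⟨.of_isExactOn hc ?_, .of_exists hc ?_ ?_⟩
  · rintro T (_ | _ | i) a ha
    · refine ⟨(show T ⟶ Y from a), ?_⟩
      change _ ≫ (disc Y).d 2 1 = a
      rw [disc_d_two_one]
      exact Category.comp_id _
    · change a ≫ (disc Y).d 2 1 = 0 at ha
      rw [disc_d_two_one] at ha
      have ha' : a = 0 := (Category.comp_id (show T ⟶ Y from a)).symm.trans ha
      exact ⟨0, by rw [ha', zero_comp]⟩
    · exact (isConcentrated_disc Y).isExactOn T (by lia) a ha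
  · exact fun T a _ => (isZero_disc_zero Y).eq_of_src _ _
  · rintro T (_ | _ | i) hi a ha
    · change (disc Y).d 2 1 ≫ a = 0 at ha
      rw [disc_d_two_one] at ha
      have ha' : a = 0 := (Category.id_comp (show Y ⟶ T from a)).symm.trans ha
      exact ⟨0, by rw [ha', comp_zero]⟩
    · refine ⟨(show Y ⟶ T from a), ?_⟩
      change (disc Y).d 2 1 ≫ _ = a
      rw [disc_d_two_one]
      exact Category.id_comp _
    · exact ⟨0, (isConcentrated_disc Y (i + 3) (by lia)).eq_of_src _ _⟩

variable {d : ℕ} {E : ObjectProperty (ChainComplex C ℕ)}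

open ZeroObject in
lemma isZero_X_zero (i : ℕ) : IsZero ((0 : ChainComplex C ℕ).X i) := by
  rw [IsZero.iff_id_eq_zero, ← HomologicalComplex.id_f, (isZero_zero _).eq_of_src (𝟙 _) 0]
  rfl

open ZeroObject in
/-- Each `Y ⟶ 0` is a deflation. For `d ≥ 2`, the complex `Y = Y` in degrees `2` and `1` is weakly
isomorphic to zero. For `d = 1` this fails, and the sequence `Y = Y ⟶ 0` is instead
the pushout of the zero sequence along `0 ⟶ Y`. -/
lemma IsDExactStructure.deflations_zero (hE : IsDExactStructure d E) (hd : 1 ≤ d) (Y : C) :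
    deflations E (0 : Y ⟶ 0) := by
  have h0 : E 0 := hE.zero 0 (isZero_zero _)
  obtain rfl | hd := hd.eq_or_lt
  · obtain ⟨D, f, e, hD, -, hf, -⟩ := hE.pushout 0 h0 Y 0
    have hD0 : IsZero (D.X 0) := (isZero_X_zero 0).of_iso (asIso (f.f 0)).symm
    have hex := (hE.isDExact D hD).1
    obtain ⟨s, hs⟩ := hex.isExactOn _ 0 (𝟙 (D.X 1)) (hD0.eq_of_tgt _ _)
    change s ≫ D.d 2 1 = _ at hs
    obtain ⟨t, ht⟩ := hex.isExactOn _ 1 (D.d 2 1 ≫ s - 𝟙 (D.X 2)) (by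
      change _ ≫ D.d 2 1 = 0
      simp [hs])
    have hs' : D.d 2 1 ≫ s = 𝟙 _ := by
      rw [← sub_eq_zero, ← ht]
      exact (hex.concentrated 3 (by lia)).eq_zero_of_tgt t ▸ zero_comp
    exact ⟨D, hD, ⟨Arrow.isoMk (e ≪≫ ⟨D.d 2 1, s, hs', hs⟩) ((isZero_zero C).iso hD0)
      (hD0.eq_of_tgt _ _)⟩⟩
  · have hD : E (disc Y) := (hE.weakIso (0 : 0 ⟶ disc Y) (hE.isDExact 0 h0)
      (isDExact_disc (by lia) Y) (Or.inr
        ⟨isIso_of_isZero (isZero_X_zero _) (isConcentrated_disc Y (d + 1) (by lia)) _,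
          isIso_of_isZero (isZero_X_zero _) (isZero_disc_zero Y) _⟩)).1 h0
    exact ⟨disc Y, hD, ⟨Arrow.isoMk (Iso.refl Y) ((isZero_zero C).iso (isZero_disc_zero Y))
      ((isZero_disc_zero Y).eq_of_tgt _ _)⟩⟩

variable [HasBinaryBiproducts C]

open ZeroObject in
lemma IsDExactStructure.deflations_desc (hE : IsDExactStructure d E) (hd : 1 ≤ d) {A B Y : C}
    {q : B ⟶ Y} (hq : deflations E q) (x : A ⟶ Y) : deflations E (biprod.desc q x) := by
  -- up to isomorphism this is the sum of `A ⟶ 0` and `𝟙 Y`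
  have h : deflations E (biprod.desc (𝟙 Y) x) := by
    refine deflations_of_arrow_iso ?_ (hE.deflations_map_id hd (hE.deflations_zero hd A) Y)
    refine Arrow.isoMk
      { hom := biprod.desc (biprod.lift (-x) (𝟙 A)) (biprod.lift (𝟙 Y) 0)
        inv := biprod.desc (biprod.lift 0 (𝟙 Y)) (biprod.lift (𝟙 A) x)
        hom_inv_id := ?_
        inv_hom_id := ?_ }
      { hom := biprod.snd
        inv := biprod.inr
        hom_inv_id := ?_
        inv_hom_id := by simp } ?_
    · apply biprod.hom_ext' <;> apply biprod.hom_ext <;> simp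
    · apply biprod.hom_ext' <;> apply biprod.hom_ext <;> simp
    · apply biprod.hom_ext'
      · exact (isZero_zero C).eq_of_src _ _
      · simp
    · apply biprod.hom_ext' <;> simp
  have e : biprod.desc q x = biprod.map q (𝟙 A) ≫ biprod.desc (𝟙 Y) x := by
    apply biprod.hom_ext' <;> simp
  rw [e]
  exact hE.deflation_comp _ _ (hE.deflations_map_id hd hq A) h

/-- Every object `Y` is the last term of a sequence in the relative class whose deflation factors
through an object of `P`, namely through a right approximation of `Y`. -/
lemma IsDExactStructure.exists_relativeClass (hE : IsDExactStructure d E) (hd : 1 ≤ d)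
    {P : ObjectProperty C} (hfin : IsContravariantlyFinite P) (hgen : IsGenerating E P) (Y : C) :
    ∃ (B : ChainComplex C ℕ) (e : B.X 0 ≅ Y) (X : C) (t : B.X 1 ⟶ X) (x : X ⟶ Y),
      relativeClass E P B ∧ P X ∧ t ≫ x = B.d 1 0 ≫ e.hom := by
  obtain ⟨X, x, hX, hx⟩ := hfin Y
  obtain ⟨Q, q, hQ, hq⟩ := hgen Y
  obtain ⟨s, rfl⟩ : ∃ s, s ≫ x = q := hx Q hQ q
  obtain ⟨B, hB, ⟨e⟩⟩ := hE.deflations_desc hd hq x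
  have w : e.inv.left ≫ biprod.desc (s ≫ x) x = B.d 1 0 ≫ e.inv.right := e.inv.w
  have w' : e.hom.left ≫ B.d 1 0 = biprod.desc (s ≫ x) x ≫ e.hom.right := e.hom.w
  have hr : e.inv.right ≫ e.hom.right = 𝟙 _ := (Arrow.rightFunc.mapIso e).inv_hom_id
  refine ⟨B, (Arrow.rightFunc.mapIso e).symm, X, e.inv.left ≫ biprod.desc s (𝟙 X), x,
    ⟨hB, ?_⟩, hX, ?_⟩
  · rw [epi_restrictedYoneda_map_iff]
    intro T hT b
    obtain ⟨a, ha⟩ := hx T hT (b ≫ e.inv.right)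
    refine ⟨(a ≫ biprod.inr) ≫ e.hom.left, ?_⟩
    change a ≫ x = _ at ha
    rw [Category.assoc, w', Category.assoc, biprod.inr_desc_assoc, reassoc_of% ha, hr]
    exact Category.comp_id _
  · refine Eq.trans ?_ w
    rw [Category.assoc]
    congr 1
    apply biprod.hom_ext' <;> simp

end ZeroDeflation

end Deflations

/-! ### Complexes that are exact on a generating subcategory -/

section RelativeAcyclic

variable {C : Type u} [Category.{v} C] [Preadditive C]
  {d : ℕ} {E : ObjectProperty (ChainComplex C ℕ)} {P : ObjectProperty C}

lemma IsExactOn.of_iso {S T : C} (e : S ≅ T) {K : ChainComplex C ℕ} {i : ℕ}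
    (h : IsExactOn S K i) : IsExactOn T K i := by
  intro a ha
  obtain ⟨b, hb⟩ := h (e.hom ≫ a) (by rw [Category.assoc, ha, comp_zero])
  exact ⟨e.inv ≫ b, by rw [Category.assoc, hb, e.inv_hom_id_assoc]⟩

/-- Let `B` be right `d`-exact and let `C(B_{j+1}, K)` be exact in degree `i + j + 1` for all `j`.
If `K_m = 0` for `m > i + d + 1`, then `C(B_0, K)` is exact in degree `i + 1`: by
descending induction on `j`, a "chain map up to boundaries" `B ⟶ K[i + 1]` is null-homotopic. -/
lemma isExactOn_of_isRightDExact {B K : ChainComplex C ℕ} (hB : IsRightDExact d B) {i : ℕ}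
    (hK : IsConcentrated (i + d + 1) K)
    (h : ∀ j, IsExactOn (B.X (j + 1)) K (i + j + 1)) : IsExactOn (B.X 0) K (i + 1) := by
  have key : ∀ m j, j + m = d + 1 → ∀ a : B.X j ⟶ K.X (i + j + 1),
      B.d (j + 1) j ≫ a ≫ K.d (i + j + 1) (i + j) = 0 →
      ∃ (s : B.X (j - 1) ⟶ K.X (i + j + 1)) (t : B.X j ⟶ K.X (i + j + 2)),
        a = B.d j (j - 1) ≫ s + t ≫ K.d (i + j + 2) (i + j + 1) := by
    intro m
    induction m with
    | zero => exact fun j hj a _ => ⟨0, 0, (hK _ (by lia)).eq_of_tgt _ _⟩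
    | succ m ih =>
      intro j hj a ha
      obtain ⟨a', ha'⟩ := h j (B.d (j + 1) j ≫ a) (by
        rw [Category.assoc]; exact ha)
      obtain ⟨s', t', hst⟩ := ih (j + 1) (by lia) a' (by
        change B.d (j + 2) (j + 1) ≫ a' ≫ K.d (i + j + 2) (i + j + 1) = 0
        rw [ha', ← Category.assoc, B.d_comp_d, zero_comp])
      change B.X j ⟶ K.X (i + j + 2) at s'
      change B.X (j + 1) ⟶ K.X (i + j + 3) at t'
      change a' = B.d (j + 1) j ≫ s' + t' ≫ K.d (i + j + 3) (i + j + 2) at hst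
      have hz : B.d (j + 1) j ≫ (a - s' ≫ K.d (i + j + 2) (i + j + 1)) = 0 := by
        rw [Preadditive.comp_sub, ← ha', hst]
        simp
      cases j with
      | zero =>
        refine ⟨0, s', ?_⟩
        have := hB.injective _ (hz.trans comp_zero.symm)
        simpa [sub_eq_zero] using this
      | succ j =>
        obtain ⟨s, hs⟩ := (hB.exact _ j (by lia) _).1 hz
        exact ⟨s, s', eq_add_of_sub_eq hs.symm⟩
  intro a ha
  obtain ⟨s, t, hst⟩ := key (d + 1) 0 (by lia) a (by
    change B.d 1 0 ≫ a ≫ K.d (i + 1) i = 0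
    rw [show a ≫ K.d (i + 1) i = 0 from ha, comp_zero])
  exact ⟨t, by simpa using hst.symm⟩

/-- A complex of length at most `d + 1` whose exactness in positive degrees holds on a generating
subcategory is left `d`-exact. -/
lemma IsDExactStructure.isLeftDExact_of_isExactOn (hE : IsDExactStructure d E)
    (hgen : IsGenerating E P) (hiso : ∀ {A B : C}, (A ≅ B) → P A → P B) {K : ChainComplex C ℕ}
    (hK : IsConcentrated (d + 1) K) (hP : ∀ T, P T → ∀ i, IsExactOn T K (i + 1)) :
    IsLeftDExact d K := by
  have key : ∀ n i, d + 1 ≤ i + n → ∀ T, IsExactOn T K (i + 1) := by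
    intro n
    induction n with
    | zero => exact fun i hi T => hK.isExactOn T (by lia)
    | succ n ih =>
      intro i hi T
      obtain ⟨X, x, hX, B, hB, ⟨e⟩⟩ := hgen T
      refine (isExactOn_of_isRightDExact (hE.isDExact B hB).2 (hK.mono (by lia)) ?_).of_iso
        (Arrow.rightFunc.mapIso e).symm
      rintro (_ | j)
      · exact hP _ (hiso (Arrow.leftFunc.mapIso e) hX) i
      · exact ih (i + (j + 1)) (by lia) _
  exact .of_isExactOn hK fun T i => key (d + 1) i (by lia) T

variable [HasBinaryBiproducts C]

/-- The mapping cone of a `d`-pullback diagram between sequences in `E` with the same first term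
is exact in positive degrees. -/
lemma isExactOn_cone_of_isDPullback {A B : ChainComplex C ℕ} (hA : IsLeftDExact d A)
    (hB : IsLeftDExact d B) (f : A ⟶ B) [hf : IsIso (f.f (d + 1))] (hpb : IsDPullback d f)
    (T : C) (i : ℕ) : IsExactOn T (cone f) (i + 1) := by
  rw [isExactOn_cone_succ_iff]
  intro a b h₁ h₂
  rcases lt_trichotomy i d with hi | rfl | hi
  · obtain ⟨a', b', -, h₁, h₂⟩ := hpb.exact T i hi a b h₁ h₂
    exact ⟨a', b', h₁.symm, h₂.symm⟩
  · have hc : f.f (i + 1) ≫ B.d (i + 1) i = A.d (i + 1) i ≫ f.f i := f.comm _ _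
    have h := hpb.injective T (a + (b ≫ inv (f.f (i + 1))) ≫ A.d (i + 1) i)
      (by simp only [Preadditive.add_comp, h₁, Category.assoc, HomologicalComplex.d_comp_d,
        comp_zero, add_zero])
      (by rw [← h₂, Preadditive.add_comp, Category.assoc, Category.assoc, ← hc,
        IsIso.inv_hom_id_assoc])
    refine ⟨b ≫ inv (f.f (i + 1)), 0, (eq_neg_of_add_eq_zero_left h).symm, by simp⟩
  · have hb : b = 0 := (hB.concentrated (i + 1) (by lia)).eq_of_tgt _ _
    obtain ⟨i, rfl⟩ : ∃ j, i = j + 1 := ⟨i - 1, by lia⟩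
    have ha : a = 0 := by
      rcases eq_or_ne i d with rfl | hi'
      · rw [← cancel_mono (f.f (i + 1)), zero_comp]
        simpa [hb] using h₂
      · exact (hA.concentrated (i + 1) (by lia)).eq_of_tgt _ _
    exact ⟨0, 0, by simp [ha], by simp [hb]⟩

variable [HasZeroObject C] [IsIdempotentComplete C]

/-- A left `d`-exact sequence whose last morphism is an epimorphism on `P` has vanishing Euler
characteristic, although it need not belong to `E`: if `A ⟶ B` is a pullback along `K_1 ⟶ K_0` of
a relative sequence `B` whose deflation factors through `K_1 ⟶ K_0`, then `K` is homotopy equivalent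
to the cone of `A ⟶ B`. -/
lemma IsDExactStructure.euler_eq_zero_of_isLeftDExact (hE : IsDExactStructure d E) (hd : 1 ≤ d)
    (hfin : IsContravariantlyFinite P) (hgen : IsGenerating E P) {K : ChainComplex C ℕ}
    (hK : IsLeftDExact d K) (hP : ∀ T, P T → IsExactOn T K 0) :
    euler d (relativeClass E P) (d + 1) K = 0 := by
  obtain ⟨B, e, X, t, x, hB, hX, htx⟩ := hE.exists_relativeClass hd hfin hgen (K.X 0)
  obtain ⟨y, hy⟩ := hP X hX x (by simp)
  change y ≫ K.d 1 0 = x at hy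
  obtain ⟨A, f, e', hA, hf₀, hf₁, hpb⟩ := hE.pullback B hB.1 (K.X 1) (K.d 1 0 ≫ e.inv)
  have hA' : relativeClass E P A := by
    refine ⟨hA, ?_⟩
    rw [epi_restrictedYoneda_map_iff]
    intro T hT a
    obtain ⟨b, hb⟩ := (epi_restrictedYoneda_map_iff P (B.d 1 0)).1 hB.2 T hT (a ≫ f.f 0)
    obtain ⟨a', -, -, ha', -⟩ := hpb.exact T 0 (by lia) a (-b) (by simp) (by simp [hb])
    exact ⟨-a', by simp [ha']⟩
  have hLA := (hE.isDExact A hA).1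
  have hLB := (hE.isDExact B hB.1).1
  have hN := isExactOn_cone_of_isDPullback hLA hLB f hpb
  obtain ⟨φ, hφ₀, hφ₁⟩ : ∃ φ : K ⟶ cone f, φ.f 0 = e.inv ∧ φ.f 1 = toCone f e'.inv 0 := by
    refine exists_hom _ _ ?_ fun i => hN _ i
    rw [toCone_d_zero, hf₀]
    simp
    rfl
  have hcone : euler d (relativeClass E P) (d + 3) (cone φ) = 0 := by
    refine euler_eq_zero_of_contractible _ _ (IsConcentrated.cone φ
      (hK.concentrated.mono (by lia))
      ((hLA.concentrated.cone f (hLB.concentrated.mono (by lia))).mono (by lia))) ?_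
    rintro T (_ | i)
    · refine isExactOn_cone_zero φ fun b => ?_
      change T ⟶ B.X 0 at b
      have hb : (b ≫ e.hom) ≫ e.inv = b := by simp
      refine ⟨b ≫ e.hom, 0, ?_⟩
      rw [hφ₀, zero_comp, add_zero]
      exact hb
    · refine isExactOn_cone_succ φ (hK.isExactOn T) (hN T) (fun a b h => ?_) i
      obtain ⟨b₁, b₂, rfl⟩ := exists_eq_toCone f b
      rw [toCone_d_zero, hφ₀, hf₀] at h
      refine ⟨b₁ ≫ e'.hom + b₂ ≫ t ≫ y, ?_⟩
      have h' : a = (b₁ ≫ e'.hom ≫ K.d 1 0 ≫ e.inv + b₂ ≫ B.d 1 0) ≫ e.hom :=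
        (Iso.comp_inv_eq e).1 h
      rw [h']
      simp [hy, htx]
  rw [euler_cone, euler_eq_of_le (m := d + 1) hK.concentrated (by lia), euler_cone,
    euler_eq_of_le (m := d + 1) hLA.concentrated (by lia),
    euler_eq_of_le (m := d + 1) hLB.concentrated (by lia), euler_eq_zero_of_mem hA',
    euler_eq_zero_of_mem hB] at hcone
  simpa using hcone

/-- A complex of length at most `d + 2` that is exact on `P` has vanishing Euler characteristic:
replacing its terms in degrees at least `2` by those of a `d`-kernel leaves, up to a shift, a
cone of length at most `d + 1`. -/
lemma IsDExactStructure.euler_eq_zero_of_isExactOn (hE : IsDExactStructure d E) (hd : 1 ≤ d)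
    (hker : HasDKernels C d) (hiso : ∀ {A B : C}, (A ≅ B) → P A → P B)
    (hfin : IsContravariantlyFinite P) (hgen : IsGenerating E P) {K : ChainComplex C ℕ}
    (hK : IsConcentrated (d + 2) K) (hP : ∀ T, P T → ∀ i, IsExactOn T K i) :
    euler d (relativeClass E P) (d + 2) K = 0 := by
  obtain ⟨L, hL, ⟨e⟩⟩ := hker (K.d 1 0)
  have w : e.hom.left ≫ L.d 1 0 = K.d 1 0 ≫ e.hom.right := e.hom.w
  let e₀ : K.X 0 ≅ L.X 0 := Arrow.rightFunc.mapIso e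
  let e₁ : K.X 1 ≅ L.X 1 := Arrow.leftFunc.mapIso e
  change e₁.hom ≫ L.d 1 0 = K.d 1 0 ≫ e₀.hom at w
  obtain ⟨φ, hφ₀, hφ₁⟩ := exists_hom e₀.hom e₁.hom w fun i => hL.isExactOn _ i
  have hL₀ : euler d (relativeClass E P) (d + 1) L = 0 := by
    refine hE.euler_eq_zero_of_isLeftDExact hd hfin hgen hL fun T hT b _ => ?_
    obtain ⟨a, ha⟩ := hP T hT 0 (b ≫ e₀.inv) (by simp)
    change a ≫ K.d 1 0 = _ at ha
    refine ⟨a ≫ e₁.hom, ?_⟩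
    change _ ≫ L.d 1 0 = b
    rw [Category.assoc, w, reassoc_of% ha, e₀.inv_hom_id, Category.comp_id]
  -- in degrees at least `2`, both `K` and `L` resolve the kernel of `K_1 ⟶ K_0` on `P`
  let ψ := ChainComplex.truncate.map (ChainComplex.truncate.map φ)
  have hψ : ∀ T, P T → ∀ i, IsExactOn T (cone ψ) i := by
    rintro T hT (_ | i)
    · refine isExactOn_cone_zero ψ fun b => ?_
      change T ⟶ L.X 2 at b
      obtain ⟨a, ha⟩ := hP T hT 1 ((b ≫ L.d 2 1) ≫ e₁.inv) (by
        change _ ≫ K.d 1 0 = 0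
        rw [← cancel_mono e₀.hom, Category.assoc, ← w]
        simp)
      change T ⟶ K.X 2 at a
      change a ≫ K.d 2 1 = _ at ha
      obtain ⟨c, hc⟩ := hL.isExactOn T 1 (b - a ≫ φ.f 2) (by
        change _ ≫ L.d 2 1 = 0
        rw [Preadditive.sub_comp, Category.assoc a, φ.comm, reassoc_of% ha, hφ₁]
        simp)
      change T ⟶ L.X 3 at c
      change c ≫ L.d 3 2 = _ at hc
      refine ⟨a, c, ?_⟩
      change a ≫ φ.f 2 + c ≫ L.d 3 2 = b
      rw [hc]
      abel
    · refine isExactOn_cone_succ ψ (fun i => hP T hT (i + 3)) (fun i => hL.isExactOn T (i + 2))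
        (fun a b h => ?_) i
      change T ⟶ K.X 2 at a
      change T ⟶ L.X 3 at b
      change a ≫ φ.f 2 = b ≫ L.d 3 2 at h
      refine hP T hT 2 a ?_
      change a ≫ K.d 2 1 = 0
      rw [← cancel_mono e₁.hom, ← hφ₁, Category.assoc, ← φ.comm, reassoc_of% h]
      simp
  have hψc : IsConcentrated (d + 1) (cone ψ) :=
    IsConcentrated.cone ψ hK.truncate.truncate
      (IsConcentrated.truncate (IsConcentrated.truncate (hL.concentrated.mono (by lia))))
  have h := hE.euler_eq_zero_of_isLeftDExact hd hfin hgen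
    (hE.isLeftDExact_of_isExactOn hgen hiso hψc fun T hT i => hψ T hT (i + 1))
    fun T hT => hψ T hT 0
  rw [euler_cone] at h
  have h₀ : K0.cls d (relativeClass E P) (K.X 0) = K0.cls d _ (L.X 0) := K0.cls_eq_of_iso _ _ e₀
  have h₁ : K0.cls d (relativeClass E P) (K.X 1) = K0.cls d _ (L.X 1) := K0.cls_eq_of_iso _ _ e₁
  have hL₁ := euler_eq_of_le (d := d) (E := relativeClass E P) (n := d + 3) hL.concentrated
    (by lia)
  rw [hL₀, euler_succ, euler_succ] at hL₁
  rw [euler_succ, euler_succ, ← hL₁, h₀]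
  congr 1
  change K0.cls d (relativeClass E P) (K.X 1) - _ = K0.cls d (relativeClass E P) (L.X 1) - _
  rw [h₁, sub_eq_zero.1 h]

end RelativeAcyclic

/-! ### Presentations of modules by morphisms of `C` -/

section Presentations

variable {C : Type u} [Category.{v} C] [Preadditive C]

/-- A presentation of the module `M` over the full subcategory `P` by a morphism `f : A ⟶ B` of
the ambient category: natural epimorphisms `C(T, B) ⟶ M(T)` for `T` in `P`, with kernel the
image of `C(T, A)`. In other words, `M` is identified with the cokernel of `C(-, f)|_P`. -/
structure Presentation (P : ObjectProperty C) {A B : C} (f : A ⟶ B)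
    (M : P.FullSubcategoryᵒᵖ ⥤ AddCommGrpCat.{v}) where
  /-- The epimorphism `C(T, B) ⟶ M(T)`. -/
  app (T : P.FullSubcategory) : (T.obj ⟶ B) →+ M.obj (.op T)
  naturality {S T : P.FullSubcategory} (g : S ⟶ T) (b : T.obj ⟶ B) :
    app S (g.hom ≫ b) = M.map g.op (app T b)
  surjective (T : P.FullSubcategory) : Function.Surjective (app T)
  exact (T : P.FullSubcategory) (b : T.obj ⟶ B) : app T b = 0 ↔ ∃ a : T.obj ⟶ A, a ≫ f = b

namespace Presentation

variable {P : ObjectProperty C} {A B : C} {f : A ⟶ B}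
  {M N : P.FullSubcategoryᵒᵖ ⥤ AddCommGrpCat.{v}}

/-- Isomorphic morphisms present the same modules. -/
def ofArrowIso (π : Presentation P f M) {A' B' : C} {f' : A' ⟶ B'}
    (e : Arrow.mk f ≅ Arrow.mk f') : Presentation P f' M where
  app T := (π.app T).comp (Preadditive.rightComp T.obj e.inv.right)
  naturality g b := by
    simp [Preadditive.rightComp, ← π.naturality]
  surjective T m := by
    obtain ⟨b, rfl⟩ := π.surjective T m
    have : e.hom.right ≫ e.inv.right = 𝟙 _ := (Arrow.rightFunc.mapIso e).hom_inv_id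
    exact ⟨b ≫ e.hom.right, by simp [Preadditive.rightComp, this]⟩
  exact T b := by
    have h : e.hom.right ≫ e.inv.right = 𝟙 _ := (Arrow.rightFunc.mapIso e).hom_inv_id
    have h' : e.inv.right ≫ e.hom.right = 𝟙 _ := (Arrow.rightFunc.mapIso e).inv_hom_id
    have w : e.inv.left ≫ f = f' ≫ e.inv.right := e.inv.w
    have w' : e.hom.left ≫ f' = f ≫ e.hom.right := e.hom.w
    refine (π.exact T (b ≫ e.inv.right)).trans ⟨?_, ?_⟩
    · rintro ⟨a, ha⟩
      refine ⟨a ≫ e.hom.left, ?_⟩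
      rw [Category.assoc, w', reassoc_of% ha, h']
      exact Category.comp_id _
    · rintro ⟨a, rfl⟩
      exact ⟨a ≫ e.inv.left, by rw [Category.assoc, w, Category.assoc]⟩

/-- A presentation of `M` presents every module isomorphic to `M`. -/
def ofIso (π : Presentation P f M) (e : M ≅ N) : Presentation P f N where
  app T := (e.hom.app (.op T)).hom.comp (π.app T)
  naturality g b := by
    simp [π.naturality]
  surjective T n := by
    obtain ⟨b, hb⟩ := π.surjective T (e.inv.app _ n)
    exact ⟨b, by simp [hb]⟩
  exact T b := by
    rw [← π.exact]
    refine ⟨fun h => ?_, fun h => by simp [h]⟩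
    have := congrArg (e.inv.app (.op T)) h
    simpa using this

lemma isAdditive (π : Presentation P f M) : M.Additive where
  map_add {S T g h} := by
    ext m
    obtain ⟨b, rfl⟩ := π.surjective S.unop m
    have hg := π.naturality g.unop b
    have hh := π.naturality h.unop b
    have hgh := π.naturality (g + h).unop b
    change M.map (g + h) (π.app _ b) = M.map g (π.app _ b) + M.map h (π.app _ b)
    refine hgh.symm.trans ((?_ : _ = _).trans (congrArg₂ (· + ·) hg hh))
    rw [← map_add, ← Preadditive.add_comp]
    rfl

/-- The tautological presentation of the cokernel of `C(-, f)|_P`. -/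
def ofCokernel (P : ObjectProperty C) {A B : C} (f : A ⟶ B) :
    Presentation P f (cokernel ((restrictedYoneda P).map f)) where
  app T := ((cokernel.π ((restrictedYoneda P).map f)).app (.op T)).hom
  naturality g b :=
    ConcreteCategory.congr_hom ((cokernel.π ((restrictedYoneda P).map f)).naturality g.op) b
  surjective T :=
    (AddCommGrpCat.epi_iff_surjective _).1
      (inferInstance : Epi ((cokernel.π ((restrictedYoneda P).map f)).app (.op T)))
  exact T b := by
    have h : (ShortComplex.mk ((restrictedYoneda P).map f) _ (cokernel.condition _)).Exact :=
      ShortComplex.exact_cokernel _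
    exact ((ShortComplex.ab_exact_iff_function_exact _).1
      (h.map ((evaluation _ _).obj (Opposite.op T)))) b

end Presentation

end Presentations

/-! ### Finitely presented modules -/

section FinitelyPresented

lemma exact_iff_evaluation {D : Type u} [Category.{v} D]
    (S : ShortComplex (D ⥤ AddCommGrpCat.{v})) :
    S.Exact ↔ ∀ T : D, Function.Exact (S.f.app T) (S.g.app T) := by
  have h : ∀ T, Function.Exact (S.f.app T) (S.g.app T) ↔
      (S.map ((evaluation _ _).obj T)).Exact := fun T =>
    (ShortComplex.ab_exact_iff_function_exact (S.map ((evaluation _ _).obj T))).symm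
  simp only [h]
  refine ⟨fun hS T => hS.map _, fun hS => ?_⟩
  rw [ShortComplex.exact_iff_isZero_homology]
  apply Functor.isZero
  intro T
  exact ((ShortComplex.exact_iff_isZero_homology _).1 (hS T)).of_iso
    (S.mapHomologyIso ((evaluation _ _).obj T)).symm

variable {C : Type u} [Category.{v} C] [Preadditive C] {P : ObjectProperty C}
  {M : P.FullSubcategoryᵒᵖ ⥤ AddCommGrpCat.{v}}

lemma exists_presentation (hM : finitelyPresented P.FullSubcategory M) :
    ∃ (A B : P.FullSubcategory) (f : A ⟶ B), Nonempty (Presentation P f.hom M) := by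
  obtain ⟨-, A, B, a, b, w, hex, hb⟩ := hM
  rw [exact_iff_evaluation] at hex
  refine ⟨A, B, preadditiveYoneda.preimage a, ⟨?_⟩⟩
  have ha : ∀ (T : P.FullSubcategory) (t : T ⟶ A),
      a.app (.op T) t = t ≫ preadditiveYoneda.preimage a := by
    intro T t
    conv_lhs => rw [← preadditiveYoneda.map_preimage a]
    rfl
  exact
    { app T := (b.app (.op T)).hom.comp
        { toFun t := ObjectProperty.homMk t
          map_zero' := rfl
          map_add' _ _ := rfl }
      naturality g t :=
        ConcreteCategory.congr_hom (b.naturality g.op) (ObjectProperty.homMk t)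
      surjective T m := by
        obtain ⟨t, rfl⟩ := (AddCommGrpCat.epi_iff_surjective _).1
          (inferInstance : Epi (b.app (.op T))) m
        exact ⟨(show T ⟶ B from t).hom, rfl⟩
      exact T t := by
        refine (hex (.op T) (ObjectProperty.homMk t)).trans ⟨?_, ?_⟩
        · rintro ⟨s, hs⟩
          refine ⟨(show T ⟶ A from s).hom, ?_⟩
          exact congrArg InducedCategory.Hom.hom ((ha T s).symm.trans hs)
        · rintro ⟨s, rfl⟩
          exact ⟨ObjectProperty.homMk s, ha T _⟩ }

lemma Presentation.finitelyPresented {A B : P.FullSubcategory} {f : A ⟶ B}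
    (π : Presentation P f.hom M) : finitelyPresented P.FullSubcategory M := by
  refine ⟨π.isAdditive, A, B, preadditiveYoneda.map f,
    { app T := AddCommGrpCat.ofHom ((π.app T.unop).comp
        { toFun t := (show T.unop ⟶ B from t).hom
          map_zero' := rfl
          map_add' _ _ := rfl })
      naturality S T g := by
        ext t
        exact π.naturality g.unop (show S.unop ⟶ B from t).hom }, ?_, ?_, ?_⟩
  · ext T t
    exact (π.exact T.unop _).2 ⟨(show T.unop ⟶ A from t).hom, rfl⟩
  · rw [exact_iff_evaluation]
    intro T t
    refine (π.exact T.unop (show T.unop ⟶ B from t).hom).trans ⟨?_, ?_⟩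
    · rintro ⟨s, hs⟩
      exact ⟨(ObjectProperty.homMk s : T.unop ⟶ A), ObjectProperty.hom_ext _ hs⟩
    · rintro ⟨s, hs⟩
      exact ⟨(show T.unop ⟶ A from s).hom, congrArg InducedCategory.Hom.hom hs⟩
  · rw [NatTrans.epi_iff_epi_app]
    intro T
    refine (AddCommGrpCat.epi_iff_surjective _).2 fun m => ?_
    obtain ⟨b, hb⟩ := π.surjective T.unop m
    exact ⟨(ObjectProperty.homMk b : T.unop ⟶ B), hb⟩

/-- The module presented by any morphism `f` of `C` is finitely presented: cover the target of `f`
by an approximation `x`, and the weak kernel of `(f, x)` by another one. -/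
lemma Presentation.finitelyPresented_of_hasDKernels [HasBinaryBiproducts C] {d : ℕ}
    (hker : HasDKernels C d) (hfin : IsContravariantlyFinite P) {A B : C} {f : A ⟶ B}
    (π : Presentation P f M) : HigherExact.finitelyPresented P.FullSubcategory M := by
  obtain ⟨X₀, x, hX₀, hx⟩ := hfin B
  obtain ⟨L, hL, ⟨e⟩⟩ := hker (biprod.desc f x)
  obtain ⟨X₁, y, hX₁, hy⟩ := hfin (L.X 2)
  have w : e.hom.left ≫ L.d 1 0 = biprod.desc f x ≫ e.hom.right := e.hom.w
  have w' : e.inv.left ≫ biprod.desc f x = L.d 1 0 ≫ e.inv.right := e.inv.w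
  have h : e.hom.left ≫ e.inv.left = 𝟙 _ := (Arrow.leftFunc.mapIso e).hom_inv_id
  let k : L.X 2 ⟶ X₀ := L.d 2 1 ≫ e.inv.left ≫ biprod.snd
  let f' : (⟨X₁, hX₁⟩ : P.FullSubcategory) ⟶ ⟨X₀, hX₀⟩ := ObjectProperty.homMk (y ≫ k)
  refine Presentation.finitelyPresented (f := f')
    { app T := (π.app T).comp (Preadditive.rightComp T.obj x)
      naturality g t := by simp [Preadditive.rightComp, ← π.naturality]
      surjective T m := ?_
      exact T t := ?_ }
  · obtain ⟨b, rfl⟩ := π.surjective T m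
    obtain ⟨t, rfl⟩ := hx T.obj T.property b
    exact ⟨t, rfl⟩
  · refine (π.exact T (t ≫ x)).trans ⟨?_, ?_⟩
    · rintro ⟨a, ha⟩
      obtain ⟨c, hc⟩ := hL.isExactOn T.obj 0 (biprod.lift (-a) t ≫ e.hom.left) (by
        change _ ≫ L.d 1 0 = 0
        have hz : biprod.lift (-a) t ≫ biprod.desc f x = 0 := by simp [ha]
        rw [Category.assoc, w, reassoc_of% hz, zero_comp])
      change c ≫ L.d 2 1 = _ at hc
      obtain ⟨c, rfl⟩ := hy T.obj T.property c
      refine ⟨c, ?_⟩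
      change c ≫ y ≫ L.d 2 1 ≫ e.inv.left ≫ biprod.snd = t
      have hc' : c ≫ y ≫ L.d 2 1 = biprod.lift (-a) t ≫ e.hom.left := by
        rw [← hc, Category.assoc]
      rw [reassoc_of% hc', reassoc_of% h]
      simp
    · rintro ⟨c, rfl⟩
      refine ⟨-(c ≫ y ≫ L.d 2 1 ≫ e.inv.left ≫ biprod.fst), ?_⟩
      change _ = (c ≫ y ≫ L.d 2 1 ≫ e.inv.left ≫ biprod.snd) ≫ x
      have hd : biprod.desc f x = biprod.fst ≫ f + biprod.snd ≫ x := by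
        apply biprod.hom_ext' <;> simp
      have hz : c ≫ y ≫ L.d 2 1 ≫ e.inv.left ≫ (biprod.fst ≫ f + biprod.snd ≫ x) = 0 := by
        rw [← hd, w']
        simp
      rw [Preadditive.neg_comp, eq_comm]
      refine eq_neg_of_add_eq_zero_right ?_
      simpa using hz

end FinitelyPresented

/-! ### Euler characteristics of modules -/

section EulerOfModules

variable {C : Type u} [Category.{v} C] [Preadditive C] [HasBinaryBiproducts C]
  {d : ℕ} {E : ObjectProperty (ChainComplex C ℕ)} {P : ObjectProperty C}

/-- Two left `d`-exact complexes whose last morphisms present the same module have the same Euler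
characteristic, as soon as the last two terms of one of them belong to `P`: the identity of the
module lifts to a chain map, and its cone is exact on `P`. -/
lemma IsDExactStructure.euler_eq_of_presentation [HasZeroObject C] [IsIdempotentComplete C]
    (hE : IsDExactStructure d E) (hd : 1 ≤ d) (hker : HasDKernels C d)
    (hadd : IsAdditiveSubcategory P) (hfin : IsContravariantlyFinite P) (hgen : IsGenerating E P)
    {M : P.FullSubcategoryᵒᵖ ⥤ AddCommGrpCat.{v}} {K L : ChainComplex C ℕ}
    (hK : IsLeftDExact d K) (hL : IsLeftDExact d L) (hK₀ : P (K.X 0)) (hK₁ : P (K.X 1))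
    (π : Presentation P (K.d 1 0) M) (ρ : Presentation P (L.d 1 0) M) :
    euler d (relativeClass E P) (d + 1) K = euler d (relativeClass E P) (d + 1) L := by
  obtain ⟨φ₀, hφ₀⟩ := ρ.surjective ⟨K.X 0, hK₀⟩ (π.app ⟨K.X 0, hK₀⟩ (𝟙 _))
  have h₀ : ∀ (T : P.FullSubcategory) (a : T.obj ⟶ K.X 0), ρ.app T (a ≫ φ₀) = π.app T a := by
    intro T a
    let g : T ⟶ ⟨K.X 0, hK₀⟩ := ObjectProperty.homMk a
    have h := ρ.naturality g φ₀
    rw [hφ₀, ← π.naturality g] at h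
    exact h.trans (congrArg _ (Category.comp_id a))
  obtain ⟨φ₁, hφ₁⟩ := (ρ.exact ⟨K.X 1, hK₁⟩ (K.d 1 0 ≫ φ₀)).1
    ((h₀ _ _).trans ((π.exact _ _).2 ⟨𝟙 _, Category.id_comp _⟩))
  obtain ⟨φ, rfl, rfl⟩ := exists_hom φ₀ φ₁ hφ₁ fun i => hL.isExactOn _ i
  have h := hE.euler_eq_zero_of_isExactOn hd hker hadd.iso hfin hgen (K := cone φ)
    (hK.concentrated.cone φ (hL.concentrated.mono (by lia))) (by
      rintro T hT (_ | i)
      · refine isExactOn_cone_zero φ fun b => ?_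
        obtain ⟨a, ha⟩ := π.surjective ⟨T, hT⟩ (ρ.app ⟨T, hT⟩ b)
        obtain ⟨c, hc⟩ := (ρ.exact ⟨T, hT⟩ (b - a ≫ φ.f 0)).1 (by
          rw [map_sub, h₀ ⟨T, hT⟩, ha, sub_self])
        exact ⟨a, c, by rw [hc]; abel⟩
      · refine isExactOn_cone_succ φ (hK.isExactOn T) (hL.isExactOn T) (fun a b h => ?_) i
        refine (π.exact ⟨T, hT⟩ a).1 ?_
        rw [← h₀ ⟨T, hT⟩ a]
        exact (ρ.exact ⟨T, hT⟩ _).2 ⟨b, h.symm⟩)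
  rw [euler_cone, euler_eq_of_le (m := d + 1) hL.concentrated (by lia), sub_eq_zero] at h
  exact h.symm

/-- Additivity on a short exact sequence `0 ⟶ M' ⟶ M ⟶ M'' ⟶ 0` of modules. If `K` resolves `M`
and `R ⟶ K_0` generates `M'`, a `d`-kernel `L` of `(K_1 ⊞ R ⟶ K_0)` resolves `M''`; the cone of
the inclusion `K ⟶ L`, after cancelling `K_0 = L_0`, resolves `M'`. -/
lemma IsDExactStructure.euler_add [HasZeroObject C] [IsIdempotentComplete C]
    (hE : IsDExactStructure d E) (hd : 1 ≤ d) (hker : HasDKernels C d)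
    (hadd : IsAdditiveSubcategory P) (hfin : IsContravariantlyFinite P) (hgen : IsGenerating E P)
    {M' M M'' : P.FullSubcategoryᵒᵖ ⥤ AddCommGrpCat.{v}} (i : M' ⟶ M) (p : M ⟶ M'')
    (hi : ∀ T, Function.Injective (i.app T)) (hip : ∀ T, Function.Exact (i.app T) (p.app T))
    (hp : ∀ T, Function.Surjective (p.app T)) {K' K K'' : ChainComplex C ℕ}
    (hK' : IsLeftDExact d K') (hK : IsLeftDExact d K) (hK'' : IsLeftDExact d K'')
    (hK'₀ : P (K'.X 0)) (hK'₁ : P (K'.X 1))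
    (hK''₀ : P (K''.X 0)) (hK''₁ : P (K''.X 1))
    (π' : Presentation P (K'.d 1 0) M') (π : Presentation P (K.d 1 0) M)
    (π'' : Presentation P (K''.d 1 0) M'') :
    euler d (relativeClass E P) (d + 1) K =
      euler d (relativeClass E P) (d + 1) K' + euler d (relativeClass E P) (d + 1) K'' := by
  set R := K'.X 0
  obtain ⟨r, hr⟩ := π.surjective ⟨R, hK'₀⟩ (i.app _ (π'.app ⟨R, hK'₀⟩ (𝟙 R)))
  have hir : ∀ (T : P.FullSubcategory) (t : T.obj ⟶ R),
      π.app T (t ≫ r) = i.app (.op T) (π'.app T t) := by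
    intro T t
    let g : T ⟶ ⟨R, hK'₀⟩ := ObjectProperty.homMk t
    have h := π.naturality g r
    rw [hr] at h
    refine h.trans ((ConcreteCategory.congr_hom (i.naturality g.op) _).symm.trans ?_)
    refine congrArg (i.app (.op T)) ((π'.naturality g (𝟙 R)).symm.trans ?_)
    exact congrArg _ (Category.comp_id t)
  have hdesc : ∀ (T : C) (t : T ⟶ K.X 1 ⊞ R), t ≫ biprod.desc (K.d 1 0) r =
      (t ≫ biprod.fst) ≫ K.d 1 0 + (t ≫ biprod.snd) ≫ r := by
    intro T t
    have : biprod.desc (K.d 1 0) r = biprod.fst ≫ K.d 1 0 + biprod.snd ≫ r := by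
      apply biprod.hom_ext' <;> simp
    rw [this]
    simp
  obtain ⟨L, hL, ⟨e⟩⟩ := hker (biprod.desc (K.d 1 0) r)
  have σ : Presentation P (biprod.desc (K.d 1 0) r) M'' :=
    { app T := (p.app (.op T)).hom.comp (π.app T)
      naturality {S T} g t := by
        refine (congrArg (p.app (.op S)) (π.naturality g t)).trans ?_
        exact ConcreteCategory.congr_hom (p.naturality g.op) _
      surjective T := (hp _).comp (π.surjective T)
      exact T b := by
        refine (hip (.op T) (π.app T b)).trans ⟨?_, ?_⟩
        · rintro ⟨m, hm⟩
          obtain ⟨t, rfl⟩ := π'.surjective T m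
          obtain ⟨a, ha⟩ := (π.exact T (b - t ≫ r)).1 (by rw [map_sub, hir, hm, sub_self])
          exact ⟨biprod.lift a t, by rw [biprod.lift_desc, ha]; abel⟩
        · rintro ⟨t, rfl⟩
          refine ⟨π'.app T (t ≫ biprod.snd), ?_⟩
          rw [hdesc, map_add, (π.exact T _).2 ⟨_, rfl⟩, zero_add, hir] }
  have w : e.hom.left ≫ L.d 1 0 = biprod.desc (K.d 1 0) r ≫ e.hom.right := e.hom.w
  have w' : e.inv.left ≫ biprod.desc (K.d 1 0) r = L.d 1 0 ≫ e.inv.right := e.inv.w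
  let e₁ : K.X 1 ⊞ R ≅ L.X 1 := Arrow.leftFunc.mapIso e
  let e₀ : K.X 0 ≅ L.X 0 := Arrow.rightFunc.mapIso e
  change e₁.hom ≫ L.d 1 0 = _ ≫ e₀.hom at w
  change e₁.inv ≫ _ = L.d 1 0 ≫ e₀.inv at w'
  have hL'' := hE.euler_eq_of_presentation hd hker hadd hfin hgen hK'' hL hK''₀ hK''₁ π''
    (σ.ofArrowIso e)
  obtain ⟨φ, hφ₀, hφ₁⟩ := exists_hom (K := K) (L := L) e₀.hom (biprod.inl ≫ e₁.hom)
    (by rw [Category.assoc, w, biprod.inl_desc_assoc]) fun i => hL.isExactOn _ i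
  let ψ := ChainComplex.truncate.map φ
  have hN : IsLeftDExact d (cone ψ) := by
    refine .of_isExactOn (IsConcentrated.cone ψ hK.concentrated.truncate
      (hL.concentrated.truncate.mono (by lia))) fun T =>
      isExactOn_cone_succ ψ (fun i => hK.isExactOn T (i + 1)) (fun i => hL.isExactOn T (i + 1))
        fun a b h => hK.isExactOn T 0 a ?_
    change T ⟶ K.X 1 at a
    change T ⟶ L.X 2 at b
    change a ≫ φ.f 1 = b ≫ L.d 2 1 at h
    change a ≫ K.d 1 0 = 0
    rw [← cancel_mono e₀.hom, ← hφ₀, Category.assoc, ← φ.comm, reassoc_of% h]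
    simp
  -- modulo `K_1`, the term `L_1 ≅ K_1 ⊞ R` of degree `0` becomes `R`, which covers `M'`
  have τ : Presentation P ((cone ψ).d 1 0) M' :=
    { app T := (π'.app T).comp
        (Preadditive.rightComp T.obj (show (cone ψ).X 0 ⟶ R from e₁.inv ≫ biprod.snd))
      naturality g b := by simp [Preadditive.rightComp, ← π'.naturality]
      surjective T m := by
        obtain ⟨t, rfl⟩ := π'.surjective T m
        change T.obj ⟶ R at t
        refine ⟨(show T.obj ⟶ L.X 1 from (t ≫ biprod.inr) ≫ e₁.hom), congrArg (π'.app T) ?_⟩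
        change ((t ≫ biprod.inr) ≫ e₁.hom) ≫ e₁.inv ≫ biprod.snd = t
        simp
      exact T b := by
        change T.obj ⟶ L.X 1 at b
        change π'.app T (b ≫ e₁.inv ≫ biprod.snd) = 0 ↔ _
        constructor
        · intro h
          have h₁ := hir T (b ≫ e₁.inv ≫ biprod.snd)
          rw [h, map_zero] at h₁
          obtain ⟨c, hc⟩ := (π.exact T _).1 h₁
          obtain ⟨l, hl⟩ := hL.isExactOn T.obj 0
            (biprod.lift (-c) (b ≫ e₁.inv ≫ biprod.snd) ≫ e₁.hom) (by
              change _ ≫ L.d 1 0 = 0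
              rw [Category.assoc, w, biprod.lift_desc_assoc, Preadditive.neg_comp, hc]
              simp)
          change T.obj ⟶ L.X 2 at l
          change l ≫ L.d 2 1 = _ at hl
          obtain ⟨a, ha⟩ : ∃ a : T.obj ⟶ K.X 1, a = b ≫ e₁.inv ≫ biprod.fst + c := ⟨_, rfl⟩
          refine ⟨toCone ψ a l, (toCone_d_zero ψ a l).trans ?_⟩
          change a ≫ φ.f 1 + l ≫ L.d 2 1 = b
          rw [ha, hl, hφ₁, ← cancel_mono e₁.inv]
          apply biprod.hom_ext <;> simp
        · rintro ⟨t, rfl⟩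
          obtain ⟨a, l, rfl⟩ := exists_eq_toCone ψ t
          rw [toCone_d_zero]
          change T.obj ⟶ K.X 1 at a
          change T.obj ⟶ L.X 2 at l
          change π'.app T ((a ≫ φ.f 1 + l ≫ L.d 2 1) ≫ e₁.inv ≫ biprod.snd) = 0
          have hl : (l ≫ L.d 2 1 ≫ e₁.inv) ≫ biprod.desc (K.d 1 0) r = 0 := by
            rw [Category.assoc, Category.assoc, w']
            simp
          rw [hdesc] at hl
          apply hi
          rw [map_zero, ← hir, hφ₁]
          refine (π.exact T _).2 ⟨-((l ≫ L.d 2 1 ≫ e₁.inv) ≫ biprod.fst), ?_⟩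
          rw [Preadditive.neg_comp, eq_comm]
          refine eq_neg_of_add_eq_zero_right ?_
          rw [← hl]
          simp }
  have hL' := hE.euler_eq_of_presentation hd hker hadd hfin hgen hK' hN hK'₀ hK'₁ π' τ
  have hLn := euler_eq_of_le (d := d) (E := relativeClass E P) (n := d + 2) hL.concentrated
    (by lia)
  rw [euler_succ] at hLn
  rw [euler_cone] at hL'
  rw [hL', hL'', euler_succ _ _ d K, ← hLn, K0.cls_eq_of_iso d _ e₀]
  abel

end EulerOfModules

/-! ### Homomorphisms out of Grothendieck groups -/

section Lift

lemma K0.exists_hom {D : Type u} [Category.{v} D] [Preadditive D] (d : ℕ)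
    (E : ObjectProperty (ChainComplex D ℕ)) {G : Type*} [AddCommGroup G] (F : D → G)
    (hiso : ∀ {A B : D}, (A ≅ B) → F A = F B)
    (hsplit : ∀ S : ShortComplex D, S.Splitting → F S.X₁ - F S.X₂ + F S.X₃ = 0)
    (hrel : ∀ B, E B → ∑ i ∈ Finset.range (d + 2), (-1 : ℤ) ^ i • F (B.X i) = 0) :
    ∃ θ : K0 d E →+ G, ∀ A, θ (K0.cls d E A) = F A := by
  let θ₀ : FreeOnIso D →+ G :=
    FreeAbelianGroup.lift (Quotient.lift F fun _ _ ⟨e⟩ => hiso e)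
  have h₀ : ∀ A, θ₀ (isoClass A) = F A := fun A => FreeAbelianGroup.lift_apply_of _ _
  let θ₁ : SplitK0 D →+ G := QuotientAddGroup.lift _ θ₀ (by
    rw [splitRelations, AddSubgroup.closure_le]
    rintro _ ⟨S, ⟨s⟩, rfl⟩
    change θ₀ _ = 0
    rw [map_add, map_sub, h₀, h₀, h₀, hsplit S s])
  have h₁ : ∀ A, θ₁ (splitClass A) = F A := h₀
  refine ⟨QuotientAddGroup.lift _ θ₁ ?_, h₁⟩
  rw [relations, AddSubgroup.closure_le]
  rintro _ ⟨B, hB, rfl⟩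
  change θ₁ _ = 0
  simp only [map_sum, map_zsmul, h₁]
  exact hrel B hB

/-- The members of `shortExactSequences` are short exact on each object. -/
lemma exact_of_shortExactSequences {D : Type u} [Category.{v} D] [Preadditive D]
    {B : ChainComplex (FPMod D) ℕ} (hB : shortExactSequences D B) :
    (∀ T, Function.Injective ((B.d 2 1).hom.app T)) ∧
      (∀ T, Function.Exact ((B.d 2 1).hom.app T) ((B.d 1 0).hom.app T)) ∧
      ∀ T, Function.Surjective ((B.d 1 0).hom.app T) := by
  let B' := ((finitelyPresented D).ι.mapHomologicalComplex (ComplexShape.down ℕ)).obj B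
  have h₀ : (B'.sc' 1 0 0).Exact :=
    (B'.exactAt_iff' 1 0 0 (by simp) (by simp)).1 (hB.2 0)
  have h₁ : (B'.sc' 2 1 0).Exact :=
    (B'.exactAt_iff' 2 1 0 (by simp) (by simp)).1 (hB.2 1)
  have h₂ : (B'.sc' 3 2 1).Exact :=
    (B'.exactAt_iff' 3 2 1 (by simp) (by simp)).1 (hB.2 2)
  rw [exact_iff_evaluation] at h₀ h₁ h₂
  refine ⟨fun T => ?_, h₁, fun T m => ?_⟩
  · refine (injective_iff_map_eq_zero ((B.d 2 1).hom.app T).hom).2 fun m hm => ?_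
    obtain ⟨n, hn⟩ := (h₂ T m).1 hm
    have hz : (B'.d 3 2).app T = 0 := by
      have : B.d 3 2 = 0 := (hB.1 3 (by lia)).eq_of_src _ _
      change (B.d 3 2).hom.app T = 0
      rw [this]
      rfl
    rw [← hn]
    change (B'.d 3 2).app T n = 0
    rw [hz]
    rfl
  · refine (h₀ T m).1 ?_
    have hz : (B'.d 0 0).app T = 0 := by
      have : B.d 0 0 = 0 := B.shape _ _ (by simp)
      change (B.d 0 0).hom.app T = 0
      rw [this]
      rfl
    change (B'.d 0 0).app T m = 0
    rw [hz]
    rfl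

end Lift

end

end HigherExact

theorem theorem1p2
    {C : Type u} [Category.{v} C] [Preadditive C] [HasZeroObject C] [HasBinaryBiproducts C]
    [EssentiallySmall.{v} C] [IsIdempotentComplete C]
    (d : ℕ) (hd : 1 ≤ d)
    (E : ObjectProperty (ChainComplex C ℕ))
    (hE : HigherExact.IsDExactStructure d E)
    (hker : HigherExact.HasDKernels C d)
    (X : ObjectProperty C)
    (hadd : HigherExact.IsAdditiveSubcategory X)
    (hfin : HigherExact.IsContravariantlyFinite X)
    (hgen : HigherExact.IsGenerating E X) :
    ∃ θ : HigherExact.K0Mod X.FullSubcategory →+ HigherExact.K0 d (HigherExact.relativeClass E X),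
      ∀ A : ChainComplex C ℕ, E A →
        ∃ hM : HigherExact.finitelyPresented X.FullSubcategory
            (cokernel ((HigherExact.restrictedYoneda X).map (A.d 1 0))),
          θ (HigherExact.K0Mod.cls
              ⟨cokernel ((HigherExact.restrictedYoneda X).map (A.d 1 0)), hM⟩) =
            ∑ i ∈ Finset.range (d + 2),
              (-1 : ℤ) ^ i • HigherExact.K0.cls d (HigherExact.relativeClass E X) (A.X i) := by
  open HigherExact in
  have hres : ∀ M : FPMod X.FullSubcategory, ∃ K : ChainComplex C ℕ, IsLeftDExact d K ∧
      X (K.X 0) ∧ X (K.X 1) ∧ Nonempty (Presentation X (K.d 1 0) M.obj) := by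
    intro M
    obtain ⟨A, B, f, ⟨π⟩⟩ := exists_presentation M.property
    obtain ⟨K, hK, ⟨e⟩⟩ := hker f.hom
    exact ⟨K, hK, hadd.iso (Arrow.rightFunc.mapIso e) B.property,
      hadd.iso (Arrow.leftFunc.mapIso e) A.property, ⟨π.ofArrowIso e⟩⟩
  choose K hK hK₀ hK₁ hπ using hres
  obtain ⟨θ, hθ⟩ := HigherExact.K0.exists_hom 1
    (HigherExact.shortExactSequences X.FullSubcategory)
    (fun M => HigherExact.euler d (HigherExact.relativeClass E X) (d + 1) (K M))
    (fun {M N} e => hE.euler_eq_of_presentation hd hker hadd hfin hgen (hK M) (hK N) (hK₀ M) (hK₁ M)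
      ((hπ M).some.ofIso ((HigherExact.finitelyPresented X.FullSubcategory).ι.mapIso e))
      (hπ N).some)
    (fun S s => by
      have hf : ∀ T m, (s.r.hom.app T) (S.f.hom.app T m) = m := fun T m =>
        ConcreteCategory.congr_hom (congrArg (fun t => t.hom.app T) s.f_r) m
      have hg : ∀ T m, (S.g.hom.app T) (s.s.hom.app T m) = m := fun T m =>
        ConcreteCategory.congr_hom (congrArg (fun t => t.hom.app T) s.s_g) m
      have hz : ∀ T m, (S.g.hom.app T) (S.f.hom.app T m) = 0 := fun T m =>
        ConcreteCategory.congr_hom (congrArg (fun t => t.hom.app T) S.zero) m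
      have hid : ∀ T m, S.f.hom.app T (s.r.hom.app T m) + s.s.hom.app T (S.g.hom.app T m) = m :=
        fun T m => ConcreteCategory.congr_hom (congrArg (fun t => t.hom.app T) s.id) m
      have h := hE.euler_add hd hker hadd hfin hgen S.f.hom S.g.hom
        (fun T => Function.LeftInverse.injective (hf T))
        (fun T m => ⟨fun h => ⟨s.r.hom.app T m, by
          have := hid T m
          rwa [h, map_zero, add_zero] at this⟩, by rintro ⟨n, rfl⟩; exact hz T n⟩)
        (fun T => Function.RightInverse.surjective (hg T))
        (hK _) (hK _) (hK _) (hK₀ _) (hK₁ _) (hK₀ _) (hK₁ _)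
        (hπ S.X₁).some (hπ S.X₂).some (hπ S.X₃).some
      rw [h]
      abel)
    (fun B hB => by
      obtain ⟨h₂, h₁, h₀⟩ := HigherExact.exact_of_shortExactSequences hB
      have h := hE.euler_add hd hker hadd hfin hgen (B.d 2 1).hom (B.d 1 0).hom h₂ h₁ h₀
        (hK _) (hK _) (hK _) (hK₀ _) (hK₁ _) (hK₀ _) (hK₁ _)
        (hπ (B.X 2)).some (hπ (B.X 1)).some (hπ (B.X 0)).some
      simp only [Finset.sum_range_succ, Finset.sum_range_zero, h]
      simp)
  refine ⟨θ, fun A hA => ?_⟩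
  have π := HigherExact.Presentation.ofCokernel X (A.d 1 0)
  refine ⟨π.finitelyPresented_of_hasDKernels hker hfin, (hθ _).trans ?_⟩
  exact hE.euler_eq_of_presentation hd hker hadd hfin hgen (hK _) (hE.isDExact A hA).1 (hK₀ _)
    (hK₁ _) (hπ _).some π
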